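/- Let $\mathrm{SL}(2,\mathbb{R})\times\mathrm{SL}(2,\mathbb{R})$ act on $\mathbb{R}^{2,3}=M(2,\mathbb{R})\oplus\mathbb{R}$, equipped with the quadratic form $\mathfrak q(X,r)=-\det X+r^2$ of signature $(2,3)$, by $(A,B)\cdot(X,r)=(AXB^{-1},r)$, and hence on the Einstein universe $\mathbb{E}\mathrm{in}^{1,2}$, the set of $\mathfrak q$-null lines of $\mathbb{R}^{2,3}$. Let $P_1,P_2$ be the two projections of $\mathrm{SL}(2,\mathbb{R})\times\mathrm{SL}(2,\mathbb{R})$ and $\mathfrak J(A,B)=(B,A)$. Put $$Y_E=\left\{\begin{bmatrix}\cos t&\sin t\\-\sin t&\cos t\end{bmatrix}\right\},\quad Y_P=\left\{\begin{bmatrix}1&s\\0&1\end{bmatrix}\right\},\quad Y_H=\left\{\begin{bmatrix}e^t&0\\0&e^{-t}\end{bmatrix}\right\},\quad \mathbb{A}\mathrm{ff}=\left\{\begin{bmatrix}e^t&s\\0&e^{-t}\end{bmatrix}\right\}\qquad(t,s\in\mathbb{R}),$$ and for $\lambda\in\mathbb{R}$ $$\mathcal G_\lambda=\left\{\left(\begin{bmatrix}\cos(\lambda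 t)&\sin(\lambda t)\\-\sin(\lambda t)&\cos(\lambda t)\end{bmatrix},\begin{bmatrix}e^t&s\\0&e^{-t}\end{bmatrix}\right):t,s\in\mathbb{R}\right\}.$$ Let $G\subset\mathrm{SL}(2,\mathbb{R})\times\mathrm{SL}(2,\mathbb{R})$ be a connected (not necessarily closed) Lie subgroup with $\dim G\ge 2$ which fixes no point of $\mathbb{E}\mathrm{in}^{1,2}$ and satisfies $P_1(G)\ne\{Id\}$ and $P_2(G)\ne\{Id\}$. Then, for $H=G$ or $H=\mathfrak J(G)$, the group $H$ is conjugate in $\mathrm{SL}(2,\mathbb{R})\times\mathrm{SL}(2,\mathbb{R})$ to one of $$Y_E\times Y_P,\quad Y_E\times Y_H,\quad Y_E\times Y_E,\quad \mathcal G_\lambda\ (\lambda\neq 0),\quad Y_E\times\mathbb{A}\mathrm{ff},\quad Y_E\times\mathrm{SL}(2,\mathbb{R}),\quad \mathrm{graph}(\varphi),$$ $$\mathrm{SL}(2,\mathbb{R})\times Y_H,\quad \mathrm{SL}(2,\mathbb{R})\times Y_P,\quad \mathrm{SL}(2,\mathbb{R})\times\mathbb{A}\mathrm{ff},\quad \mathrm{SL}(2,\mathbb{R})\times\mathrm{SL}(2,\mathbb{R}),$$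 where $\varphi$ is a Lie group automorphism of $\mathrm{SL}(2,\mathbb{R})$ which is not a conjugation by an element of $\mathrm{SL}(2,\mathbb{R})$. Moreover, for the same $H$, the group of transformations of $\mathbb{R}^{2,3}$ defined by $H$ is conjugate by a linear isometry of $(\mathbb{R}^{2,3},\mathfrak q)$ (that is, by a conformal transformation of $\mathbb{E}\mathrm{in}^{1,2}$) to the one defined by a group of this list in which $\lambda>0$ for the groups $\mathcal G_\lambda$. -/

import Mathlib

noncomputable section

namespace EinAdS

/-- Real `2 × 2` matrices. -/
abbrev M2 : Type := Matrix (Fin 2) (Fin 2) ℝ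

/-- The group `SL(2, ℝ)`. -/
abbrev SL2 : Type := Matrix.SpecialLinearGroup (Fin 2) ℝ

/-! ### The Einstein universe `Ein^{1,2}` and the action of `SL(2, ℝ) × SL(2, ℝ)` on it -/

/-- The vector space `M(2, ℝ) ⊕ ℝ`, a model of `ℝ^{2,3}` with the form `einForm`. -/
abbrev R23 : Type := M2 × ℝ

/-- The quadratic form `(X, r) ↦ - det X + r²` on `M(2, ℝ) ⊕ ℝ`. -/
def einForm (v : R23) : ℝ := -v.1.det + v.2 ^ 2

/-- The form `einForm` has signature `(2, 3)`. -/
theorem einForm_signature :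
    ∃ e : (Fin 5 → ℝ) ≃ₗ[ℝ] R23, ∀ x : Fin 5 → ℝ,
      einForm (e x) = -(x 0) ^ 2 - (x 1) ^ 2 + (x 2) ^ 2 + (x 3) ^ 2 + (x 4) ^ 2 := by
  let f : (Fin 5 → ℝ) →ₗ[ℝ] R23 :=
    { toFun := fun x => (!![x 0 + x 2, x 1 + x 3; x 3 - x 1, x 0 - x 2], x 4)
      map_add' := by
        intro x y
        ext i j
        · fin_cases i <;> fin_cases j <;> simp <;> ring
        · simp
      map_smul' := by
        intro c x
        ext i j
        · fin_cases i <;> fin_cases j <;> simp <;> ring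
        · simp }
  have hf : Function.Injective f := by
    rw [injective_iff_map_eq_zero]
    intro x hx
    have h1 : (!![x 0 + x 2, x 1 + x 3; x 3 - x 1, x 0 - x 2] : M2) = 0 := congrArg Prod.fst hx
    have h2 : x 4 = 0 := congrArg Prod.snd hx
    have h00 := congrFun (congrFun h1 0) 0
    have h01 := congrFun (congrFun h1 0) 1
    have h10 := congrFun (congrFun h1 1) 0
    have h11 := congrFun (congrFun h1 1) 1
    simp at h00 h01 h10 h11
    ext i
    fin_cases i <;> simp <;> linarith
  have hd : Module.finrank ℝ (Fin 5 → ℝ) = Module.finrank ℝ R23 := by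
    simp [Module.finrank_matrix]
  refine ⟨LinearEquiv.ofInjectiveOfFinrankEq f hf hd, fun x => ?_⟩
  have : LinearEquiv.ofInjectiveOfFinrankEq f hf hd x
      = (!![x 0 + x 2, x 1 + x 3; x 3 - x 1, x 0 - x 2], x 4) := rfl
  rw [this]
  simp [einForm, Matrix.det_fin_two]
  ring

/-- The Einstein universe `Ein^{1,2}`: the set of null lines in `ℝ^{2,3}`. -/
def Ein12 : Set (Projectivization ℝ R23) := {p | ∀ v ∈ p.submodule, einForm v = 0}

/-- The linear action of `SL(2, ℝ) × SL(2, ℝ)` on `ℝ^{2,3} = M(2, ℝ) ⊕ ℝ`,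
`(A, B) · (X, r) = (A X B⁻¹, r)`. -/
def rep : SL2 × SL2 →* (R23 ≃ₗ[ℝ] R23) where
  toFun g :=
    { toFun := fun v => ((g.1 : M2) * v.1 * ((g.2⁻¹ : SL2) : M2), v.2)
      invFun := fun v => (((g.1⁻¹ : SL2) : M2) * v.1 * (g.2 : M2), v.2)
      map_add' := by
        intro v w
        simp [mul_add, add_mul]
      map_smul' := by
        intro c v
        simp
      left_inv := by
        intro v
        have h1 : ((g.1⁻¹ : SL2) : M2) * (g.1 : M2) = 1 := by
          rw [← Matrix.SpecialLinearGroup.coe_mul, inv_mul_cancel,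
            Matrix.SpecialLinearGroup.coe_one]
        have h2 : ((g.2⁻¹ : SL2) : M2) * (g.2 : M2) = 1 := by
          rw [← Matrix.SpecialLinearGroup.coe_mul, inv_mul_cancel,
            Matrix.SpecialLinearGroup.coe_one]
        refine Prod.ext ?_ rfl
        change ((g.1⁻¹ : SL2) : M2) * ((g.1 : M2) * v.1 * ((g.2⁻¹ : SL2) : M2)) * (g.2 : M2) = v.1
        rw [Matrix.mul_assoc, Matrix.mul_assoc _ _ (g.2 : M2), h2, Matrix.mul_one,
          ← Matrix.mul_assoc, h1, Matrix.one_mul]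
      right_inv := by
        intro v
        have h1 : (g.1 : M2) * ((g.1⁻¹ : SL2) : M2) = 1 := by
          rw [← Matrix.SpecialLinearGroup.coe_mul, mul_inv_cancel,
            Matrix.SpecialLinearGroup.coe_one]
        have h2 : (g.2 : M2) * ((g.2⁻¹ : SL2) : M2) = 1 := by
          rw [← Matrix.SpecialLinearGroup.coe_mul, mul_inv_cancel,
            Matrix.SpecialLinearGroup.coe_one]
        refine Prod.ext ?_ rfl
        change (g.1 : M2) * (((g.1⁻¹ : SL2) : M2) * v.1 * (g.2 : M2)) * ((g.2⁻¹ : SL2) : M2) = v.1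
        rw [Matrix.mul_assoc, Matrix.mul_assoc _ (g.2 : M2), h2, Matrix.mul_one,
          ← Matrix.mul_assoc, h1, Matrix.one_mul] }
  map_one' := by
    refine LinearEquiv.ext fun v => Prod.ext ?_ rfl
    change ((1 : SL2) : M2) * v.1 * (((1 : SL2)⁻¹ : SL2) : M2) = v.1
    rw [inv_one, Matrix.SpecialLinearGroup.coe_one, Matrix.one_mul, Matrix.mul_one]
  map_mul' := by
    intro g h
    refine LinearEquiv.ext fun v => Prod.ext ?_ rfl
    change ((g.1 * h.1 : SL2) : M2) * v.1 * (((g.2 * h.2)⁻¹ : SL2) : M2)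
      = (g.1 : M2) * ((h.1 : M2) * v.1 * ((h.2⁻¹ : SL2) : M2)) * ((g.2⁻¹ : SL2) : M2)
    rw [mul_inv_rev, Matrix.SpecialLinearGroup.coe_mul, Matrix.SpecialLinearGroup.coe_mul]
    simp only [Matrix.mul_assoc]

/-- The action of `SL(2, ℝ) × SL(2, ℝ)` preserves the quadratic form. -/
theorem einForm_rep (g : SL2 × SL2) (v : R23) : einForm (rep g v) = einForm v := by
  change -((g.1 : M2) * v.1 * ((g.2⁻¹ : SL2) : M2)).det + v.2 ^ 2 = _
  rw [Matrix.det_mul, Matrix.det_mul, g.1.det_coe, (g.2⁻¹).det_coe]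
  simp [einForm]

/-- `G` fixes some point of `Ein^{1,2}`. -/
def FixesPointEin12 (G : Subgroup (SL2 × SL2)) : Prop :=
  ∃ p ∈ Ein12, ∀ g ∈ G,
    Projectivization.map (rep g).toLinearMap (rep g).injective p = p

/-! ### Connected Lie subgroups -/

/-- `G` is a connected (not necessarily closed) Lie subgroup of `SL(2, ℝ) × SL(2, ℝ)` with Lie
algebra `𝔤`: the generators of the one-parameter groups contained in `G` form the
linear subspace `𝔤`, which is closed under the Lie bracket, and `G` is generated by the
exponentials of the elements of `𝔤`. (The elements of such a `𝔤` automatically have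
trace-free components.) -/
structure IsConnectedLieSubgroup (G : Subgroup (SL2 × SL2)) (𝔤 : Submodule ℝ (M2 × M2)) :
    Prop where
  lie_mem : ∀ X ∈ 𝔤, ∀ Y ∈ 𝔤, (X.1 * Y.1 - Y.1 * X.1, X.2 * Y.2 - Y.2 * X.2) ∈ 𝔤
  mem_iff : ∀ X : M2 × M2, X ∈ 𝔤 ↔ ∀ t : ℝ, ∃ g ∈ G,
    (g.1 : M2) = NormedSpace.exp (t • X.1) ∧ (g.2 : M2) = NormedSpace.exp (t • X.2)
  generated : G ≤ Subgroup.closure {g | ∃ X ∈ 𝔤,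
    (g.1 : M2) = NormedSpace.exp X.1 ∧ (g.2 : M2) = NormedSpace.exp X.2}

/-! ### The model subgroups -/

/-- The rotation `[cos t, sin t; -sin t, cos t]`. -/
def rot (t : ℝ) : SL2 :=
  ⟨!![Real.cos t, Real.sin t; -Real.sin t, Real.cos t], by
    rw [Matrix.det_fin_two_of]
    nlinarith [Real.sin_sq_add_cos_sq t]⟩

/-- The upper triangular matrix `[eᵗ, s; 0, e⁻ᵗ]`. -/
def tri (t s : ℝ) : SL2 :=
  ⟨!![Real.exp t, s; 0, Real.exp (-t)], by
    rw [Matrix.det_fin_two_of, ← Real.exp_add]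
    simp⟩

theorem rot_zero : rot 0 = 1 := by
  apply Subtype.ext
  ext i j
  fin_cases i <;> fin_cases j <;> simp [rot]

theorem rot_mul (a b : ℝ) : rot a * rot b = rot (a + b) := by
  apply Subtype.ext
  rw [Matrix.SpecialLinearGroup.coe_mul]
  ext i j
  fin_cases i <;> fin_cases j <;>
    simp [rot, Matrix.mul_apply, Fin.sum_univ_two, Real.cos_add, Real.sin_add] <;> ring

theorem rot_inv (a : ℝ) : (rot a)⁻¹ = rot (-a) := by
  rw [inv_eq_iff_mul_eq_one, rot_mul, add_neg_cancel, rot_zero]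

theorem tri_zero : tri 0 0 = 1 := by
  apply Subtype.ext
  ext i j
  fin_cases i <;> fin_cases j <;> simp [tri]

theorem tri_mul (t s t' s' : ℝ) :
    tri t s * tri t' s' = tri (t + t') (Real.exp t * s' + s * Real.exp (-t')) := by
  apply Subtype.ext
  rw [Matrix.SpecialLinearGroup.coe_mul]
  ext i j
  fin_cases i <;> fin_cases j <;>
    simp [tri, Matrix.mul_apply, Fin.sum_univ_two, Real.exp_add, mul_comm]

theorem tri_inv (t s : ℝ) : (tri t s)⁻¹ = tri (-t) (-s) := by
  rw [inv_eq_iff_mul_eq_one, tri_mul, add_neg_cancel, neg_neg,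
    show Real.exp t * -s + s * Real.exp t = 0 by ring, tri_zero]

/-- The elliptic one-parameter subgroup: the stabilizer `SO(2)` of `i` in the upper half-plane. -/
def YE : Subgroup SL2 where
  carrier := {A | ∃ t, A = rot t}
  mul_mem' := by
    rintro _ _ ⟨a, rfl⟩ ⟨b, rfl⟩
    exact ⟨a + b, rot_mul a b⟩
  one_mem' := ⟨0, rot_zero.symm⟩
  inv_mem' := by
    rintro _ ⟨a, rfl⟩
    exact ⟨-a, rot_inv a⟩

/-- The parabolic one-parameter subgroup of the matrices `[1, s; 0, 1]`. -/
def YP : Subgroup SL2 where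
  carrier := {A | ∃ s, A = tri 0 s}
  mul_mem' := by
    rintro _ _ ⟨a, rfl⟩ ⟨b, rfl⟩
    exact ⟨_, by rw [tri_mul, add_zero]⟩
  one_mem' := ⟨0, tri_zero.symm⟩
  inv_mem' := by
    rintro _ ⟨a, rfl⟩
    exact ⟨-a, by rw [tri_inv, neg_zero]⟩

/-- The hyperbolic one-parameter subgroup of the matrices `[eᵗ, 0; 0, e⁻ᵗ]`. -/
def YH : Subgroup SL2 where
  carrier := {A | ∃ t, A = tri t 0}
  mul_mem' := by
    rintro _ _ ⟨a, rfl⟩ ⟨b, rfl⟩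
    exact ⟨a + b, by rw [tri_mul, mul_zero, zero_mul, add_zero]⟩
  one_mem' := ⟨0, tri_zero.symm⟩
  inv_mem' := by
    rintro _ ⟨a, rfl⟩
    exact ⟨-a, by rw [tri_inv, neg_zero]⟩

/-- The connected affine group of the matrices `[eᵗ, s; 0, e⁻ᵗ]`. -/
def Aff : Subgroup SL2 where
  carrier := {A | ∃ t s, A = tri t s}
  mul_mem' := by
    rintro _ _ ⟨a, s, rfl⟩ ⟨b, s', rfl⟩
    exact ⟨_, _, tri_mul a s b s'⟩
  one_mem' := ⟨0, 0, tri_zero.symm⟩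
  inv_mem' := by
    rintro _ ⟨a, s, rfl⟩
    exact ⟨-a, -s, tri_inv a s⟩

/-- The subgroup `𝒢_λ` of `Y_E × Aff`. -/
def twistedGroup (lam : ℝ) : Subgroup (SL2 × SL2) where
  carrier := {g | ∃ t s, g = (rot (lam * t), tri t s)}
  mul_mem' := by
    rintro _ _ ⟨a, s, rfl⟩ ⟨b, s', rfl⟩
    exact ⟨a + b, _, by rw [Prod.mk_mul_mk, rot_mul, tri_mul, mul_add]⟩
  one_mem' := ⟨0, 0, by rw [mul_zero, rot_zero, tri_zero, Prod.mk_one_one]⟩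
  inv_mem' := by
    rintro _ ⟨a, s, rfl⟩
    exact ⟨-a, -s, by rw [Prod.inv_mk, rot_inv, tri_inv, mul_neg]⟩

/-- `K` is one of the subgroups of the list, where `lam` in `𝒢_lam` ranges over `Λ`.
The automorphisms `φ` of `SL(2, ℝ)` are automorphisms of the Lie group (that is, continuous
group automorphisms with continuous inverse) which are not conjugations by elements of
`SL(2, ℝ)`. -/
inductive Listed (Λ : Set ℝ) : Subgroup (SL2 × SL2) → Prop
  | elliptic_parabolic : Listed Λ (YE.prod YP)
  | elliptic_hyperbolic : Listed Λ (YE.prod YH)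
  | elliptic_elliptic : Listed Λ (YE.prod YE)
  | twisted (lam : ℝ) (h : lam ∈ Λ) : Listed Λ (twistedGroup lam)
  | elliptic_affine : Listed Λ (YE.prod Aff)
  | elliptic_full : Listed Λ (YE.prod ⊤)
  | graph (φ : SL2 ≃ₜ* SL2) (h : ∀ B : SL2, ∃ A : SL2, φ A ≠ B * A * B⁻¹) :
      Listed Λ (φ.toMulEquiv.toMonoidHom.graph)
  | full_hyperbolic : Listed Λ ((⊤ : Subgroup SL2).prod YH)
  | full_parabolic : Listed Λ ((⊤ : Subgroup SL2).prod YP)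
  | full_affine : Listed Λ ((⊤ : Subgroup SL2).prod Aff)
  | full_full : Listed Λ ((⊤ : Subgroup SL2).prod ⊤)

/-! ### Conjugacy -/

/-- The image `𝔍(G)` of `G` under the swap `(A, B) ↦ (B, A)`. -/
def swapSubgroup (G : Subgroup (SL2 × SL2)) : Subgroup (SL2 × SL2) :=
  G.map (MulEquiv.prodComm : SL2 × SL2 ≃* SL2 × SL2).toMonoidHom

/-- `H` and `K` are conjugate in `SL(2, ℝ) × SL(2, ℝ)`. -/
def ConjInSL (H K : Subgroup (SL2 × SL2)) : Prop :=
  ∃ g : SL2 × SL2, H.map (MulAut.conj g).toMonoidHom = K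

/-- The groups of transformations of `ℝ^{2,3}` given by `H` and `K` are conjugate by a
linear isometry of `ℝ^{2,3}`, that is, by a conformal transformation of `Ein^{1,2}`. -/
def ConjInConf (H K : Subgroup (SL2 × SL2)) : Prop :=
  ∃ F : R23 ≃ₗ[ℝ] R23, (∀ v, einForm (F v) = einForm v) ∧
    (H.map rep).map (MulAut.conj F).toMonoidHom = K.map rep

end EinAdS

end

noncomputable section

namespace EinAdS

open NormedSpace LinearMap

/-! ### The exponential of real `2 × 2` matrices -/

/-! `G` is generated by the exponentials of `𝔤` (`IsConnectedLieSubgroup.eq_expGroup`), so the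
classification takes place in `sl(2, ℝ) × sl(2, ℝ)`. Both projections of `𝔤` are nonzero subalgebras
of `sl(2, ℝ)`. The two factors can be conjugated independently, so each projection may be assumed to
be `so(2)`, a parabolic or hyperbolic line, the upper triangular algebra, or everything
(`exists_conj_isModel`).

If both projections are upper triangular, the nilpotent matrix `tf 0 1 0` spans an invariant null
line, which is excluded. Hence, up to the swap, the first projection is `so(2)` or `sl(2, ℝ)`, and
Goursat's argument applies to the ideals cut out by `𝔤` in the two factors.

Over `so(2)` (`listed_of_fst_elliptic`), `𝔤` is a product, or its ideal in the second factor has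
codimension one in the second projection. This ideal is nonzero since `dim 𝔤 ≥ 2`, so simplicity of
`sl(2, ℝ)` leaves only the upper triangular case, which gives `𝒢_λ`.

Over `sl(2, ℝ)`, simplicity makes `𝔤` a product (`listed_of_fst_full`, `listed_of_full`) or the
graph of an automorphism. The latter is conjugation by some `D` in `GL(2, ℝ)`
(`exists_conj_of_graph`). If `det D > 0`, the vector `(adj D, √det D)` is null and fixed; so `det D
< 0`, and the automorphism is not inner.

Finally, conjugation by `diag(1, -1)` is an isometry exchanging `𝒢_λ` and `𝒢_{-λ}`. -/

theorem mul_exp_of_mul_eq {U X Y : M2} (h : U * X = Y * U) : U * exp X = exp Y * U := by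
  let _ : NormedRing M2 := Matrix.linftyOpNormedRing
  let _ : NormedAlgebra ℝ M2 := Matrix.linftyOpNormedAlgebra
  have hpow : ∀ n : ℕ, U * X ^ n = Y ^ n * U := by
    intro n
    induction n with
    | zero => simp
    | succ n ih => rw [pow_succ, ← mul_assoc, ih, mul_assoc, h, ← mul_assoc, ← pow_succ]
  have h1 := (exp_series_hasSum_exp' (𝕂 := ℝ) X).mul_left U
  have h2 := (exp_series_hasSum_exp' (𝕂 := ℝ) Y).mul_right U
  refine h1.unique (h2.congr_fun ?_) |>.trans rfl
  intro n
  simp [hpow]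

theorem exp_add_of_commute' {X Y : M2} (h : Commute X Y) : exp (X + Y) = exp X * exp Y :=
  Matrix.exp_add_of_commute X Y h

theorem exp_smul_one (c : ℝ) : exp (c • (1 : M2)) = Real.exp c • (1 : M2) := by
  rw [← Matrix.diagonal_one, ← Matrix.diagonal_smul, Matrix.exp_diagonal, ← Matrix.diagonal_smul]
  congr 1
  funext i
  rw [Pi.coe_exp]
  simp [Real.exp_eq_exp_ℝ]

/-- An infinitesimal weight vector is a weight vector of the one-parameter group. -/
theorem exp_mul_of_mul_sub {X Y Z : M2} {c : ℝ} (h : X * Z - Z * Y = c • Z) :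
    exp X * Z = Real.exp c • (Z * exp Y) := by
  -- `Z`, possibly singular, intertwines `X` with `c + Y`; the scalar then splits off the
  -- exponential.
  have h1 : Z * (c • (1 : M2) + Y) = X * Z := by
    rw [mul_add, mul_smul_comm, mul_one, ← h, sub_add_cancel]
  rw [← mul_exp_of_mul_eq h1, exp_add_of_commute' ((Commute.one_left Y).smul_left c),
    exp_smul_one, smul_mul_assoc, one_mul, mul_smul_comm]

/-- With `J` the standard symplectic matrix, `Xᵀ J + J X = (tr X) J`. Exponentiating gives `exp(X)ᵀ
J exp(X) = e^{tr X} J`, whose left side is `det (exp X) J`. -/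
theorem det_exp (X : M2) : (exp X).det = Real.exp X.trace := by
  have h1 : X.transpose * !![0, 1; -1, 0] - !![0, 1; -1, 0] * (-X)
      = X.trace • (!![0, 1; -1, 0] : M2) := by
    ext i j
    fin_cases i <;> fin_cases j <;>
      simp [Matrix.mul_apply, Fin.sum_univ_two, Matrix.trace, Matrix.vecMul_eq_sum] <;> ring
  have h2 := exp_mul_of_mul_sub h1
  rw [Matrix.exp_transpose] at h2
  have h3 : exp (-X) * exp X = 1 := by
    rw [← exp_add_of_commute' (Commute.neg_left rfl), neg_add_cancel, exp_zero]
  have h4 := congrArg (· * exp X) h2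
  simp only [smul_mul_assoc, mul_assoc, h3] at h4
  have h5 := congrFun (congrFun h4 0) 1
  simp [Matrix.mul_apply, Fin.sum_univ_two, Matrix.vecMul_eq_sum] at h5
  rw [Matrix.det_fin_two, ← h5]
  ring

/-! ### A basis of the Lie algebra `sl(2, ℝ)` -/

/-- The trace-free matrix with entries `a`, `b`, `c`, `-a`. -/
def tf (a b c : ℝ) : M2 := !![a, b; c, -a]

@[simp] theorem tf_add (a b c a' b' c' : ℝ) :
    tf a b c + tf a' b' c' = tf (a + a') (b + b') (c + c') := by
  ext i j; fin_cases i <;> fin_cases j <;> simp [tf]; ring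

@[simp] theorem tf_sub (a b c a' b' c' : ℝ) :
    tf a b c - tf a' b' c' = tf (a - a') (b - b') (c - c') := by
  ext i j; fin_cases i <;> fin_cases j <;> simp [tf]; ring

@[simp] theorem smul_tf (r a b c : ℝ) : r • tf a b c = tf (r * a) (r * b) (r * c) := by
  ext i j; fin_cases i <;> fin_cases j <;> simp [tf]

@[simp] theorem neg_tf (a b c : ℝ) : -tf a b c = tf (-a) (-b) (-c) := by
  ext i j; fin_cases i <;> fin_cases j <;> simp [tf]

theorem tf_zero : tf 0 0 0 = 0 := by
  ext i j; fin_cases i <;> fin_cases j <;> simp [tf]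

theorem tf_inj {a b c a' b' c' : ℝ} : tf a b c = tf a' b' c' ↔ a = a' ∧ b = b' ∧ c = c' := by
  refine ⟨fun h => ⟨?_, ?_, ?_⟩, by rintro ⟨rfl, rfl, rfl⟩; rfl⟩
  · simpa [tf] using congrFun (congrFun h 0) 0
  · simpa [tf] using congrFun (congrFun h 0) 1
  · simpa [tf] using congrFun (congrFun h 1) 0

@[simp] theorem tf_eq_zero {a b c : ℝ} : tf a b c = 0 ↔ a = 0 ∧ b = 0 ∧ c = 0 := by
  rw [← tf_zero, tf_inj]

@[simp] theorem tf_lie (a b c a' b' c' : ℝ) :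
    tf a b c * tf a' b' c' - tf a' b' c' * tf a b c
      = tf (b * c' - b' * c) (2 * (a * b' - a' * b)) (2 * (a' * c - a * c')) := by
  ext i j; fin_cases i <;> fin_cases j <;> simp [tf] <;> ring

theorem eq_tf_of_trace {X : M2} (h : X.trace = 0) : X = tf (X 0 0) (X 0 1) (X 1 0) := by
  rw [Matrix.trace_fin_two] at h
  ext i j; fin_cases i <;> fin_cases j <;> simp [tf]; linarith

@[simp] theorem trace_tf (a b c : ℝ) : (tf a b c).trace = 0 := by simp [tf, Matrix.trace_fin_two]

/-! ### Explicit one-parameter subgroups -/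

theorem coe_tri (t s : ℝ) : (tri t s : M2) = !![Real.exp t, s; 0, Real.exp (-t)] := rfl

theorem coe_rot (t : ℝ) : (rot t : M2) = !![Real.cos t, Real.sin t; -Real.sin t, Real.cos t] := rfl

theorem exp_hyperbolic (t : ℝ) : exp (tf t 0 0) = (tri t 0 : M2) := by
  have : tf t 0 0 = Matrix.diagonal ![t, -t] := by
    ext i j; fin_cases i <;> fin_cases j <;> simp [tf]
  rw [this, Matrix.exp_diagonal, coe_tri]
  ext i j; fin_cases i <;> fin_cases j <;> simp [Pi.coe_exp, Real.exp_eq_exp_ℝ]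

theorem exp_parabolic (s : ℝ) : exp (tf 0 s 0) = (tri 0 s : M2) := by
  let _ : NormedRing M2 := Matrix.linftyOpNormedRing
  let _ : NormedAlgebra ℝ M2 := Matrix.linftyOpNormedAlgebra
  have hsq : tf 0 s 0 ^ 2 = 0 := by
    rw [sq]
    ext i j; fin_cases i <;> fin_cases j <;> simp [tf]
  have h := hasSum_sum_of_ne_finset_zero (L := SummationFilter.unconditional ℕ)
    (f := fun n : ℕ => ((n.factorial : ℝ)⁻¹) • tf 0 s 0 ^ n)
    (s := Finset.range 2) (by
      intro n hn
      rw [Finset.mem_range, not_lt] at hn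
      rw [← Nat.sub_add_cancel hn, pow_add, hsq, mul_zero, smul_zero])
  refine (exp_series_hasSum_exp' (𝕂 := ℝ) (tf 0 s 0)).unique h |>.trans ?_
  ext i j
  fin_cases i <;> fin_cases j <;> simp [Finset.sum_range_succ, tf, coe_tri]

/-- The matrix `tf 0 1 (-1)` squares to `-1`, so it spans a copy of `ℂ` inside the matrices, and the
formula is Euler's. -/
theorem exp_elliptic (t : ℝ) : exp (tf 0 t (-t)) = (rot t : M2) := by
  let _ : NormedRing M2 := Matrix.linftyOpNormedRing
  let _ : NormedAlgebra ℝ M2 := Matrix.linftyOpNormedAlgebra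
  let _ : NormedAlgebra ℚ M2 := NormedAlgebra.restrictScalars ℚ ℝ M2
  let f : ℂ →ₐ[ℝ] M2 := Complex.liftAux (tf 0 1 (-1)) (by
    ext i j; fin_cases i <;> fin_cases j <;> simp [tf])
  have hf : Continuous f := f.toLinearMap.continuous_of_finiteDimensional
  have h := map_exp f hf ((t : ℂ) * Complex.I)
  rw [← Complex.exp_eq_exp_ℂ] at h
  have h1 : f ((t : ℂ) * Complex.I) = tf 0 t (-t) := by
    simp [f, Complex.liftAux_apply]
  rw [h1] at h
  refine h.symm.trans ?_
  rw [Complex.liftAux_apply, coe_rot]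
  ext i j
  fin_cases i <;> fin_cases j <;> simp [tf, Complex.exp_ofReal_mul_I_re, Complex.exp_ofReal_mul_I_im,
    Matrix.algebraMap_matrix_apply]

theorem exp_upper (t s : ℝ) : ∃ s', exp (tf t s 0) = (tri t s' : M2) := by
  by_cases ht : t = 0
  · subst ht
    exact ⟨s, exp_parabolic s⟩
  -- For `t ≠ 0` this unipotent diagonalizes `tf t s 0`.
  have h : (tri 0 (s / (2 * t)) : M2) * tf t s 0 = tf t 0 0 * (tri 0 (s / (2 * t)) : M2) := by
    ext i j
    fin_cases i <;> fin_cases j <;>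
      simp [tf, coe_tri, Matrix.mul_apply, Fin.sum_univ_two] <;> field_simp <;> ring
  have h2 := congrArg (fun Z => (tri 0 (-(s / (2 * t))) : M2) * Z) (mul_exp_of_mul_eq h)
  simp only [exp_hyperbolic, ← mul_assoc, ← Matrix.SpecialLinearGroup.coe_mul, tri_mul] at h2
  exact ⟨_, by simpa [tri_zero] using h2⟩

/-! ### The groups generated by exponentials -/

/-- The elements of `SL(2, ℝ)` which are exponentials of elements of `𝔭`. -/
def expSet (𝔭 : Submodule ℝ M2) : Set SL2 := {A | ∃ X ∈ 𝔭, (A : M2) = exp X}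

/-- The elements of `SL(2, ℝ) × SL(2, ℝ)` which are exponentials of elements of `𝔤`. -/
def expSetProd (𝔤 : Submodule ℝ (M2 × M2)) : Set (SL2 × SL2) :=
  {g | ∃ X ∈ 𝔤, (g.1 : M2) = exp X.1 ∧ (g.2 : M2) = exp X.2}

/-- The subgroup generated by the exponentials of elements of `𝔤`. -/
def expGroup (𝔤 : Submodule ℝ (M2 × M2)) : Subgroup (SL2 × SL2) := Subgroup.closure (expSetProd 𝔤)

theorem IsConnectedLieSubgroup.eq_expGroup {G : Subgroup (SL2 × SL2)}
    {𝔤 : Submodule ℝ (M2 × M2)} (hG : IsConnectedLieSubgroup G 𝔤) : G = expGroup 𝔤 := by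
  refine le_antisymm hG.generated ((Subgroup.closure_le _).2 ?_)
  rintro ⟨A, B⟩ ⟨X, hX, h1, h2⟩
  obtain ⟨⟨A', B'⟩, hg, h1', h2'⟩ := (hG.mem_iff X).1 hX 1
  rw [one_smul] at h1' h2'
  have hA : A = A' := Subtype.ext (h1.trans h1'.symm)
  have hB : B = B' := Subtype.ext (h2.trans h2'.symm)
  rw [hA, hB]
  exact hg

theorem IsConnectedLieSubgroup.trace_eq_zero {G : Subgroup (SL2 × SL2)}
    {𝔤 : Submodule ℝ (M2 × M2)} (hG : IsConnectedLieSubgroup G 𝔤) {X : M2 × M2} (hX : X ∈ 𝔤) :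
    X.1.trace = 0 ∧ X.2.trace = 0 := by
  obtain ⟨g, -, h1, h2⟩ := (hG.mem_iff X).1 hX 1
  rw [one_smul] at h1 h2
  have h1' := congrArg Matrix.det h1
  have h2' := congrArg Matrix.det h2
  rw [det_exp, g.1.det_coe, eq_comm, Real.exp_eq_one_iff] at h1'
  rw [det_exp, g.2.det_coe, eq_comm, Real.exp_eq_one_iff] at h2'
  exact ⟨h1', h2'⟩

theorem one_mem_expSet (𝔭 : Submodule ℝ M2) : (1 : SL2) ∈ expSet 𝔭 :=
  ⟨0, 𝔭.zero_mem, by rw [exp_zero, Matrix.SpecialLinearGroup.coe_one]⟩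

theorem expGroup_prod (𝔭 𝔮 : Submodule ℝ M2) :
    expGroup (𝔭.prod 𝔮) = (Subgroup.closure (expSet 𝔭)).prod (Subgroup.closure (expSet 𝔮)) := by
  have h : expSetProd (𝔭.prod 𝔮) = expSet 𝔭 ×ˢ expSet 𝔮 := ?_
  · rw [← Subgroup.closure_prod (one_mem_expSet 𝔭) (one_mem_expSet 𝔮), expGroup, h]
  ext ⟨A, B⟩
  constructor
  · rintro ⟨⟨X, Y⟩, ⟨hX, hY⟩, h1, h2⟩
    exact ⟨⟨X, hX, h1⟩, ⟨Y, hY, h2⟩⟩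
  · rintro ⟨⟨X, hX, h1⟩, ⟨Y, hY, h2⟩⟩
    exact ⟨(X, Y), ⟨hX, hY⟩, h1, h2⟩

/-! ### The model subalgebras of `sl(2, ℝ)` -/

/-- The Lie algebra of trace-free matrices. -/
def slAlg : Submodule ℝ M2 := LinearMap.ker (Matrix.traceLinearMap (Fin 2) ℝ ℝ)

/-- The Lie algebra of trace-free upper triangular matrices. -/
def affAlg : Submodule ℝ M2 := Submodule.span ℝ {tf 1 0 0, tf 0 1 0}

theorem mem_slAlg_iff {X : M2} : X ∈ slAlg ↔ ∃ a b c, X = tf a b c := by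
  constructor
  · intro h
    exact ⟨_, _, _, eq_tf_of_trace h⟩
  · rintro ⟨a, b, c, rfl⟩
    exact trace_tf a b c

theorem mem_affAlg_iff {X : M2} : X ∈ affAlg ↔ ∃ a b, X = tf a b 0 := by
  rw [affAlg, Submodule.mem_span_pair]
  simp [eq_comm]

theorem mem_span_elliptic_iff {X : M2} :
    X ∈ Submodule.span ℝ {tf 0 1 (-1)} ↔ ∃ t, X = tf 0 t (-t) := by
  rw [Submodule.mem_span_singleton]
  simp [eq_comm]

theorem mem_span_parabolic_iff {X : M2} :
    X ∈ Submodule.span ℝ {tf 0 1 0} ↔ ∃ t, X = tf 0 t 0 := by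
  rw [Submodule.mem_span_singleton]
  simp [eq_comm]

theorem mem_span_hyperbolic_iff {X : M2} :
    X ∈ Submodule.span ℝ {tf 1 0 0} ↔ ∃ t, X = tf t 0 0 := by
  rw [Submodule.mem_span_singleton]
  simp [eq_comm]

theorem tf_mem_slAlg (a b c : ℝ) : tf a b c ∈ slAlg := mem_slAlg_iff.2 ⟨a, b, c, rfl⟩

theorem closure_expSet_elliptic :
    Subgroup.closure (expSet (Submodule.span ℝ {tf 0 1 (-1)})) = YE := by
  refine le_antisymm ((Subgroup.closure_le _).2 ?_) ?_
  · rintro A ⟨X, hX, h⟩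
    obtain ⟨t, rfl⟩ := mem_span_elliptic_iff.1 hX
    exact ⟨t, Subtype.ext (h.trans (exp_elliptic t))⟩
  · rintro _ ⟨t, rfl⟩
    exact Subgroup.subset_closure ⟨_, mem_span_elliptic_iff.2 ⟨t, rfl⟩, (exp_elliptic t).symm⟩

theorem closure_expSet_parabolic :
    Subgroup.closure (expSet (Submodule.span ℝ {tf 0 1 0})) = YP := by
  refine le_antisymm ((Subgroup.closure_le _).2 ?_) ?_
  · rintro A ⟨X, hX, h⟩
    obtain ⟨t, rfl⟩ := mem_span_parabolic_iff.1 hX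
    exact ⟨t, Subtype.ext (h.trans (exp_parabolic t))⟩
  · rintro _ ⟨t, rfl⟩
    exact Subgroup.subset_closure ⟨_, mem_span_parabolic_iff.2 ⟨t, rfl⟩, (exp_parabolic t).symm⟩

theorem closure_expSet_hyperbolic :
    Subgroup.closure (expSet (Submodule.span ℝ {tf 1 0 0})) = YH := by
  refine le_antisymm ((Subgroup.closure_le _).2 ?_) ?_
  · rintro A ⟨X, hX, h⟩
    obtain ⟨t, rfl⟩ := mem_span_hyperbolic_iff.1 hX
    exact ⟨t, Subtype.ext (h.trans (exp_hyperbolic t))⟩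
  · rintro _ ⟨t, rfl⟩
    exact Subgroup.subset_closure ⟨_, mem_span_hyperbolic_iff.2 ⟨t, rfl⟩, (exp_hyperbolic t).symm⟩

theorem tri_eq_mul (t s : ℝ) : tri t s = tri t 0 * tri 0 (Real.exp (-t) * s) := by
  rw [tri_mul, ← mul_assoc, ← Real.exp_add]
  simp

theorem closure_expSet_affine : Subgroup.closure (expSet affAlg) = Aff := by
  refine le_antisymm ((Subgroup.closure_le _).2 ?_) ?_
  · rintro A ⟨X, hX, h⟩
    obtain ⟨t, s, rfl⟩ := mem_affAlg_iff.1 hX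
    obtain ⟨s', hs'⟩ := exp_upper t s
    exact ⟨t, s', Subtype.ext (h.trans hs')⟩
  · rintro _ ⟨t, s, rfl⟩
    rw [tri_eq_mul]
    exact mul_mem
      (Subgroup.subset_closure ⟨_, mem_affAlg_iff.2 ⟨t, 0, rfl⟩, (exp_hyperbolic t).symm⟩)
      (Subgroup.subset_closure ⟨_, mem_affAlg_iff.2 ⟨0, _, rfl⟩, (exp_parabolic _).symm⟩)

/-- The lower triangular unipotent matrix `[1, 0; c, 1]`. -/
def lowerUnip (c : ℝ) : SL2 := ⟨!![1, 0; c, 1], by simp⟩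

theorem exp_lower (c : ℝ) : exp (tf 0 0 c) = (lowerUnip c : M2) := by
  have h : (tf 0 c 0).transpose = tf 0 0 c := by
    ext i j; fin_cases i <;> fin_cases j <;> simp [tf]
  rw [← h, Matrix.exp_transpose, exp_parabolic]
  ext i j; fin_cases i <;> fin_cases j <;> simp [coe_tri, lowerUnip]

/-- The exponential is not onto `SL(2, ℝ)`, but upper and lower unipotents are exponentials and
generate the group. -/
theorem closure_expSet_slAlg : Subgroup.closure (expSet slAlg) = ⊤ := by
  set S := Subgroup.closure (expSet slAlg)
  have hU : ∀ s, tri 0 s ∈ S := fun s =>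
    Subgroup.subset_closure ⟨_, tf_mem_slAlg 0 s 0, (exp_parabolic s).symm⟩
  have hL : ∀ s, lowerUnip s ∈ S := fun s =>
    Subgroup.subset_closure ⟨_, tf_mem_slAlg 0 0 s, (exp_lower s).symm⟩
  have key : ∀ A : SL2, A 1 0 ≠ 0 → A ∈ S := by
    intro A hA
    have : A = tri 0 ((A 0 0 - 1) / A 1 0) * lowerUnip (A 1 0) * tri 0 ((A 1 1 - 1) / A 1 0) := by
      have hd := A.det_coe
      rw [Matrix.det_fin_two] at hd
      apply Subtype.ext
      rw [Matrix.SpecialLinearGroup.coe_mul, Matrix.SpecialLinearGroup.coe_mul]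
      ext i j
      fin_cases i <;> fin_cases j <;>
        simp [coe_tri, lowerUnip, Matrix.mul_apply, Fin.sum_univ_two] <;> field_simp <;> linarith
    rw [this]
    exact mul_mem (mul_mem (hU _) (hL _)) (hU _)
  refine (Subgroup.eq_top_iff' _).2 fun A => ?_
  by_cases hA : A 1 0 = 0
  -- Multiplying by `lowerUnip 1` makes the lower left entry `A 0 0`, which is nonzero since `det A
  -- = 1`.
  · rw [← Subgroup.mul_mem_cancel_left S (hL 1)]
    apply key
    have hd := A.det_coe
    rw [Matrix.det_fin_two, hA, mul_zero, sub_zero] at hd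
    have : A 0 0 ≠ 0 := left_ne_zero_of_mul_eq_one hd
    rw [Matrix.SpecialLinearGroup.coe_mul]
    simpa [lowerUnip, Matrix.mul_apply, Fin.sum_univ_two, hA] using this
  · exact key A hA

/-- The Lie algebra of `twistedGroup lam`. -/
def twistedAlg (lam : ℝ) : Submodule ℝ (M2 × M2) :=
  Submodule.span ℝ {(tf 0 lam (-lam), tf 1 0 0), (0, tf 0 1 0)}

theorem mem_twistedAlg_iff {lam : ℝ} {X : M2 × M2} :
    X ∈ twistedAlg lam ↔ ∃ t s, X = (tf 0 (lam * t) (-(lam * t)), tf t s 0) := by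
  rw [twistedAlg, Submodule.mem_span_pair]
  simp [eq_comm, mul_comm]

theorem expGroup_twistedAlg (lam : ℝ) : expGroup (twistedAlg lam) = twistedGroup lam := by
  refine le_antisymm ((Subgroup.closure_le _).2 ?_) ?_
  · rintro ⟨A, B⟩ ⟨X, hX, h1, h2⟩
    obtain ⟨t, s, rfl⟩ := mem_twistedAlg_iff.1 hX
    obtain ⟨s', hs'⟩ := exp_upper t s
    exact ⟨t, s', Prod.ext (Subtype.ext (h1.trans (exp_elliptic _))) (Subtype.ext (h2.trans hs'))⟩
  · rintro _ ⟨t, s, rfl⟩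
    have : (rot (lam * t), tri t s)
        = (rot (lam * t), tri t 0) * (rot (lam * 0), tri 0 (Real.exp (-t) * s)) := by
      rw [Prod.mk_mul_mk, ← tri_eq_mul, rot_mul, mul_zero, add_zero]
    rw [this]
    exact mul_mem
      (Subgroup.subset_closure ⟨_, mem_twistedAlg_iff.2 ⟨t, 0, rfl⟩,
        (exp_elliptic _).symm, (exp_hyperbolic t).symm⟩)
      (Subgroup.subset_closure ⟨_, mem_twistedAlg_iff.2 ⟨0, _, rfl⟩,
        (exp_elliptic _).symm, (exp_parabolic _).symm⟩)

/-! ### Conjugation and swap -/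

theorem coe_mul_coe_inv (P : SL2) : (P : M2) * ((P⁻¹ : SL2) : M2) = 1 := by
  rw [← Matrix.SpecialLinearGroup.coe_mul, mul_inv_cancel, Matrix.SpecialLinearGroup.coe_one]

theorem coe_inv_mul_coe (P : SL2) : ((P⁻¹ : SL2) : M2) * (P : M2) = 1 := by
  rw [← Matrix.SpecialLinearGroup.coe_mul, inv_mul_cancel, Matrix.SpecialLinearGroup.coe_one]

/-- The adjoint action of `SL(2, ℝ)` on matrices. -/
def conjLin (P : SL2) : M2 ≃ₗ[ℝ] M2 where
  toFun X := (P : M2) * X * ((P⁻¹ : SL2) : M2)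
  invFun X := ((P⁻¹ : SL2) : M2) * X * (P : M2)
  map_add' X Y := by rw [mul_add, add_mul]
  map_smul' c X := by simp
  left_inv X := by
    simp only [mul_assoc, coe_inv_mul_coe, mul_one]
    rw [← mul_assoc, coe_inv_mul_coe, one_mul]
  right_inv X := by
    simp only [mul_assoc, coe_mul_coe_inv, mul_one]
    rw [← mul_assoc, coe_mul_coe_inv, one_mul]

theorem conjLin_apply (P : SL2) (X : M2) : conjLin P X = (P : M2) * X * ((P⁻¹ : SL2) : M2) := rfl

theorem conjLin_mul (P : SL2) (X Y : M2) : conjLin P (X * Y) = conjLin P X * conjLin P Y := by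
  simp only [conjLin_apply, mul_assoc]
  rw [← mul_assoc _ (P : M2), coe_inv_mul_coe, one_mul]

theorem trace_conjLin (P : SL2) (X : M2) : (conjLin P X).trace = X.trace := by
  rw [conjLin_apply, Matrix.trace_mul_comm, ← mul_assoc, coe_inv_mul_coe, one_mul]

theorem exp_conjLin (P : SL2) (X : M2) : exp (conjLin P X) = conjLin P (exp X) := by
  have h : (P : M2) * X = conjLin P X * P := by
    rw [conjLin_apply, mul_assoc, coe_inv_mul_coe, mul_one]
  rw [conjLin_apply P (exp X), mul_exp_of_mul_eq h, mul_assoc, coe_mul_coe_inv, mul_one]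

theorem coe_conj (P A : SL2) : ((P * A * P⁻¹ : SL2) : M2) = conjLin P A := by
  rw [conjLin_apply, Matrix.SpecialLinearGroup.coe_mul, Matrix.SpecialLinearGroup.coe_mul]

/-- The adjoint action of `SL(2, ℝ) × SL(2, ℝ)`. -/
def conjLinProd (g : SL2 × SL2) : (M2 × M2) ≃ₗ[ℝ] (M2 × M2) :=
  (conjLin g.1).prodCongr (conjLin g.2)

theorem conjLinProd_apply (g : SL2 × SL2) (X : M2 × M2) :
    conjLinProd g X = (conjLin g.1 X.1, conjLin g.2 X.2) := rfl

theorem map_conj_expGroup (g : SL2 × SL2) (𝔤 : Submodule ℝ (M2 × M2)) :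
    (expGroup 𝔤).map (MulAut.conj g).toMonoidHom
      = expGroup (𝔤.map (conjLinProd g).toLinearMap) := by
  rw [expGroup, MonoidHom.map_closure, expGroup]
  congr 1
  ext h
  constructor
  · rintro ⟨k, ⟨X, hX, h1, h2⟩, rfl⟩
    refine ⟨conjLinProd g X, Submodule.mem_map_of_mem hX, ?_, ?_⟩
    · exact (coe_conj g.1 k.1).trans (by rw [h1, conjLinProd_apply, exp_conjLin])
    · exact (coe_conj g.2 k.2).trans (by rw [h2, conjLinProd_apply, exp_conjLin])
  · rintro ⟨_, ⟨X, hX, rfl⟩, h1, h2⟩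
    refine ⟨g⁻¹ * h * g, ⟨X, hX, ?_, ?_⟩, ?_⟩
    · apply (conjLin g.1).injective
      rw [← exp_conjLin, ← coe_conj]
      refine Eq.trans ?_ h1
      congr 1
      simp [mul_assoc]
      rfl
    · apply (conjLin g.2).injective
      rw [← exp_conjLin, ← coe_conj]
      refine Eq.trans ?_ h2
      congr 1
      simp [mul_assoc]
      rfl
    · simp [mul_assoc]

theorem swapSubgroup_expGroup (𝔤 : Submodule ℝ (M2 × M2)) :
    swapSubgroup (expGroup 𝔤)
      = expGroup (𝔤.map (LinearEquiv.prodComm ℝ M2 M2).toLinearMap) := by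
  rw [swapSubgroup, expGroup, MonoidHom.map_closure, expGroup]
  congr 1
  ext ⟨A, B⟩
  constructor
  · rintro ⟨k, ⟨X, hX, h1, h2⟩, h⟩
    obtain ⟨rfl, rfl⟩ : k.2 = A ∧ k.1 = B := by simpa [Prod.ext_iff] using h
    exact ⟨X.swap, Submodule.mem_map_of_mem hX, h2, h1⟩
  · rintro ⟨_, ⟨X, hX, rfl⟩, h1, h2⟩
    exact ⟨(B, A), ⟨X, hX, h2, h1⟩, rfl⟩

/-! ### Lie subalgebras of `sl(2, ℝ)` up to conjugacy -/

/-- Used with the columns of `Q` an adapted basis for the normal form `Y`. -/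
theorem conjLin_inv_eq {Q : SL2} {X Y : M2} (h : X * Q = Q * Y) : conjLin Q⁻¹ X = Y := by
  rw [conjLin_apply, inv_inv, mul_assoc, h, ← mul_assoc, coe_inv_mul_coe, one_mul]

theorem exists_conj_nilpotent {a b c : ℝ} (h : tf a b c ≠ 0) (hd : a ^ 2 + b * c = 0) :
    ∃ (P : SL2) (k : ℝ), k ≠ 0 ∧ conjLin P (tf a b c) = k • tf 0 1 0 := by
  by_cases hc : c = 0
  · subst hc
    have ha : a = 0 := by simpa using hd
    subst ha
    refine ⟨(1 : SL2)⁻¹, b, by simpa using h, conjLin_inv_eq ?_⟩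
    simp
  -- The first column spans the kernel; the second is `e₁`, which is mapped to `-c` times the first.
  · refine ⟨(⟨!![-a / c, 1; -1, 0], by simp⟩ : SL2)⁻¹, -c, neg_ne_zero.2 hc, conjLin_inv_eq ?_⟩
    ext i j
    fin_cases i <;> fin_cases j <;> simp [tf, Matrix.mul_apply, Fin.sum_univ_two] <;>
      field_simp <;> linarith

theorem exists_conj_hyperbolic {a b c : ℝ} (hd : 0 < a ^ 2 + b * c) :
    ∃ (P : SL2) (k : ℝ), k ≠ 0 ∧ conjLin P (tf a b c) = k • tf 1 0 0 := by
  by_cases hc : c = 0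
  · subst hc
    have ha : a ≠ 0 := by rintro rfl; simp at hd
    refine ⟨(⟨!![1, -b / (2 * a); 0, 1], by simp⟩ : SL2)⁻¹, a, ha, conjLin_inv_eq ?_⟩
    ext i j
    fin_cases i <;> fin_cases j <;> simp [tf, Matrix.mul_apply, Fin.sum_univ_two] <;>
      field_simp <;> ring
  · obtain ⟨k, hk, hk2⟩ : ∃ k : ℝ, 0 < k ∧ k ^ 2 = a ^ 2 + b * c :=
      ⟨√(a ^ 2 + b * c), Real.sqrt_pos.2 hd, Real.sq_sqrt hd.le⟩
    have hk0 := hk.ne'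
    -- Eigenvectors for `k` and `-k`, the first rescaled so that the determinant is one.
    refine ⟨(⟨!![(a + k) / (2 * k * c), a - k; c / (2 * k * c), c], ?_⟩ : SL2)⁻¹, k, hk0,
      conjLin_inv_eq ?_⟩
    · rw [Matrix.det_fin_two_of]
      field_simp
      ring
    ext i j
    fin_cases i <;> fin_cases j <;> simp [tf, Matrix.mul_apply, Fin.sum_univ_two] <;>
      field_simp <;> linarith

theorem exists_conj_elliptic {a b c : ℝ} (hd : a ^ 2 + b * c < 0) :
    ∃ (P : SL2) (k : ℝ), k ≠ 0 ∧ conjLin P (tf a b c) = k • tf 0 1 (-1) := by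
  have hc : c ≠ 0 := by
    rintro rfl
    nlinarith [sq_nonneg a]
  -- The two directions of rotation are not conjugate in `SL(2, ℝ)`: the sign of `k` is forced by
  -- requiring a conjugator of determinant one, namely `α ^ 2 = -k / c`.
  obtain ⟨k, hk2, hk⟩ : ∃ k : ℝ, k ^ 2 = -(a ^ 2 + b * c) ∧ 0 < -k / c := by
    have h1 : √(-(a ^ 2 + b * c)) ^ 2 = -(a ^ 2 + b * c) := Real.sq_sqrt (by linarith)
    have h2 : 0 < √(-(a ^ 2 + b * c)) := Real.sqrt_pos.2 (by linarith)
    rcases hc.lt_or_gt with h | h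
    · exact ⟨_, h1, div_pos_of_neg_of_neg (by linarith) h⟩
    · exact ⟨-√(-(a ^ 2 + b * c)), by rw [neg_sq, h1], div_pos (by linarith) h⟩
  have hk0 : k ≠ 0 := by
    rintro rfl
    simp at hk
  obtain ⟨α, hα⟩ : ∃ α : ℝ, α ^ 2 = -k / c := ⟨√(-k / c), Real.sq_sqrt hk.le⟩
  refine ⟨(⟨!![α, -α * a / k; 0, -α * c / k], ?_⟩ : SL2)⁻¹, k, hk0, conjLin_inv_eq ?_⟩
  · rw [Matrix.det_fin_two_of, mul_zero, sub_zero,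
      show α * (-α * c / k) = -(α ^ 2) * c / k by ring, hα]
    field_simp
  ext i j
  fin_cases i <;> fin_cases j <;> simp [tf, Matrix.mul_apply, Fin.sum_univ_two] <;>
    field_simp <;> first | ring1 | linear_combination (-α) * hk2

/-- The conjugacy classes of nonzero Lie subalgebras of `sl(2, ℝ)`. -/
inductive IsModel : Submodule ℝ M2 → Prop
  | elliptic : IsModel (Submodule.span ℝ {tf 0 1 (-1)})
  | parabolic : IsModel (Submodule.span ℝ {tf 0 1 0})
  | hyperbolic : IsModel (Submodule.span ℝ {tf 1 0 0})
  | affine : IsModel affAlg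
  | full : IsModel slAlg

theorem map_conjLin_span {P : SL2} {X Y : M2} {k : ℝ} (hk : k ≠ 0) (h : conjLin P X = k • Y) :
    (Submodule.span ℝ {X}).map (conjLin P).toLinearMap = Submodule.span ℝ {Y} := by
  rw [Submodule.map_span, Set.image_singleton]
  change Submodule.span ℝ {conjLin P X} = _
  rw [h, Submodule.span_singleton_smul_eq hk.isUnit]

theorem finrank_slAlg : Module.finrank ℝ slAlg = 3 := by
  have h := LinearMap.finrank_range_add_finrank_ker (Matrix.traceLinearMap (Fin 2) ℝ ℝ)
  have h1 : LinearMap.range (Matrix.traceLinearMap (Fin 2) ℝ ℝ) = ⊤ := by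
    refine LinearMap.range_eq_top.2 fun x => ⟨!![x, 0; 0, 0], ?_⟩
    simp [Matrix.trace_fin_two]
  rw [h1, finrank_top, Module.finrank_self, Module.finrank_matrix] at h
  simp at h
  change 1 + Module.finrank ℝ slAlg = 4 at h
  omega

theorem finrank_affAlg : Module.finrank ℝ affAlg = 2 := by
  have h : LinearIndependent ℝ ![tf 1 0 0, tf 0 1 0] := by
    rw [LinearIndependent.pair_iff]
    intro s t h
    simpa using h
  have hr : Set.range ![tf 1 0 0, tf 0 1 0] = {tf 1 0 0, tf 0 1 0} := by
    ext X
    simp [or_comm]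
  rw [affAlg, ← hr]
  exact finrank_span_eq_card h

/-- Commuting elements of `sl(2, ℝ)` are proportional, so the bracket `Z` of a basis is nonzero. It
is trace-orthogonal to both basis vectors, hence to all of `𝔭`, including itself; so `Z` is
nilpotent. Once `Z` is a multiple of `tf 0 1 0`, orthogonality to it says exactly that the lower
left entry vanishes. -/
theorem exists_conj_affAlg {𝔭 : Submodule ℝ M2} (hsl : 𝔭 ≤ slAlg)
    (hlie : ∀ X ∈ 𝔭, ∀ Y ∈ 𝔭, X * Y - Y * X ∈ 𝔭) (hdim : Module.finrank ℝ 𝔭 = 2) :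
    ∃ P : SL2, 𝔭.map (conjLin P).toLinearMap = affAlg := by
  obtain ⟨X, hX, hX0⟩ := 𝔭.exists_mem_ne_zero_of_ne_bot (by
    rintro rfl
    simp at hdim)
  have hXle : Submodule.span ℝ {X} ≤ 𝔭 := by simpa using hX
  have hX1 := finrank_span_singleton (K := ℝ) hX0
  have hlt : Submodule.span ℝ {X} < 𝔭 := lt_of_le_of_ne hXle (by rintro h; rw [h] at hX1; omega)
  obtain ⟨Y, hY, hYX⟩ := SetLike.exists_of_lt hlt
  have hspan : Submodule.span ℝ {X, Y} = 𝔭 := by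
    refine Submodule.eq_of_le_of_finrank_le (Submodule.span_le.2 ?_) ?_
    · rintro _ (rfl | rfl) <;> assumption
    · have : Submodule.span ℝ {X} < Submodule.span ℝ {X, Y} := by
        refine lt_of_le_of_ne (Submodule.span_mono (by simp)) fun h => hYX ?_
        rw [h]
        exact Submodule.subset_span (by simp)
      have := Submodule.finrank_lt_finrank_of_lt this
      omega
  obtain ⟨a, b, c, rfl⟩ := mem_slAlg_iff.1 (hsl hX)
  obtain ⟨a', b', c', rfl⟩ := mem_slAlg_iff.1 (hsl hY)
  have hZ := hlie _ hX _ hY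
  rw [tf_lie] at hZ
  have hZ0 : tf (b * c' - b' * c) (2 * (a * b' - a' * b)) (2 * (a' * c - a * c')) ≠ 0 := by
    intro h
    rw [tf_eq_zero] at h
    obtain ⟨h1, h2, h3⟩ := h
    apply hYX
    rw [Submodule.mem_span_singleton]
    simp only [smul_tf, tf_inj]
    by_cases ha : a = 0
    · by_cases hb : b = 0
      · have hc : c ≠ 0 := by rintro rfl; simp [ha, hb] at hX0
        refine ⟨c' / c, ?_, ?_, ?_⟩ <;> field_simp <;> linarith
      · refine ⟨b' / b, ?_, ?_, ?_⟩ <;> field_simp <;> linarith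
    · refine ⟨a' / a, ?_, ?_, ?_⟩ <;> field_simp <;> linarith
  obtain ⟨α, β, hαβ⟩ := Submodule.mem_span_pair.1 (hspan ▸ hZ)
  simp only [smul_tf, tf_add, tf_inj] at hαβ
  obtain ⟨e1, e2, e3⟩ := hαβ
  obtain ⟨P, k, hk, hP⟩ := exists_conj_nilpotent hZ0 (by
    linear_combination (-(b * c' - b' * c)) * e1 - (a' * c - a * c') * e2
      - (a * b' - a' * b) * e3)
  refine ⟨P, Submodule.eq_of_le_of_finrank_eq ?_ ?_⟩
  · rintro _ ⟨W, hW, rfl⟩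
    have htr : (tf (b * c' - b' * c) (2 * (a * b' - a' * b)) (2 * (a' * c - a * c')) * W).trace
        = 0 := by
      obtain ⟨x, y, rfl⟩ := Submodule.mem_span_pair.1 (hspan.symm ▸ hW)
      simp [tf, Matrix.trace_fin_two]
      ring
    have htr0 : (conjLin P W).trace = 0 := (trace_conjLin P W).trans (hsl hW)
    rw [← trace_conjLin P, conjLin_mul, hP] at htr
    change conjLin P W ∈ affAlg
    rw [eq_tf_of_trace htr0] at htr ⊢
    rw [mem_affAlg_iff]
    refine ⟨_, _, tf_inj.2 ⟨rfl, rfl, ?_⟩⟩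
    simpa [tf, Matrix.trace_fin_two, hk] using htr
  · rw [LinearEquiv.finrank_map_eq, hdim, finrank_affAlg]

theorem exists_conj_isModel {𝔭 : Submodule ℝ M2} (hsl : 𝔭 ≤ slAlg) (h0 : 𝔭 ≠ ⊥)
    (hlie : ∀ X ∈ 𝔭, ∀ Y ∈ 𝔭, X * Y - Y * X ∈ 𝔭) :
    ∃ P : SL2, IsModel (𝔭.map (conjLin P).toLinearMap) := by
  have hle := Submodule.finrank_mono hsl
  rw [finrank_slAlg] at hle
  obtain ⟨X, hX, hX0⟩ := 𝔭.exists_mem_ne_zero_of_ne_bot h0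
  have hXle : Submodule.span ℝ {X} ≤ 𝔭 := by simpa using hX
  have hX1 := finrank_span_singleton (K := ℝ) hX0
  have hpos := Submodule.finrank_mono hXle
  obtain h | h | h : Module.finrank ℝ 𝔭 = 1 ∨ Module.finrank ℝ 𝔭 = 2 ∨ Module.finrank ℝ 𝔭 = 3 := by
    omega
  · obtain rfl := Submodule.eq_of_le_of_finrank_eq hXle (by omega)
    obtain ⟨a, b, c, rfl⟩ := mem_slAlg_iff.1 (hsl hX)
    rcases lt_trichotomy (a ^ 2 + b * c) 0 with hd | hd | hd
    · obtain ⟨P, k, hk, hP⟩ := exists_conj_elliptic hd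
      exact ⟨P, by rw [map_conjLin_span hk hP]; exact .elliptic⟩
    · obtain ⟨P, k, hk, hP⟩ := exists_conj_nilpotent hX0 hd
      exact ⟨P, by rw [map_conjLin_span hk hP]; exact .parabolic⟩
    · obtain ⟨P, k, hk, hP⟩ := exists_conj_hyperbolic hd
      exact ⟨P, by rw [map_conjLin_span hk hP]; exact .hyperbolic⟩
  · obtain ⟨P, hP⟩ := exists_conj_affAlg hsl hlie h
    exact ⟨P, by rw [hP]; exact .affine⟩
  · obtain rfl := Submodule.eq_of_le_of_finrank_eq hsl (by rw [h, finrank_slAlg])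
    have h1 : (conjLin 1).toLinearMap = LinearMap.id := by
      ext1 X
      simp [conjLin_apply]
    exact ⟨1, by rw [h1, Submodule.map_id]; exact .full⟩

/-- `sl(2, ℝ)` is simple. -/
theorem eq_slAlg_of_ideal {𝔨 : Submodule ℝ M2} (hsl : 𝔨 ≤ slAlg) (h0 : 𝔨 ≠ ⊥)
    (hid : ∀ X ∈ slAlg, ∀ Y ∈ 𝔨, X * Y - Y * X ∈ 𝔨) : 𝔨 = slAlg := by
  have lie : ∀ {a b c : ℝ} (a' b' c' : ℝ), tf a b c ∈ 𝔨 →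
      tf (b' * c - b * c') (2 * (a' * b - a * b')) (2 * (a * c' - a' * c)) ∈ 𝔨 :=
    fun a' b' c' h => tf_lie a' b' c' _ _ _ ▸ hid _ (tf_mem_slAlg a' b' c') _ h
  have hH : tf 1 0 0 ∈ 𝔨 := by
    obtain ⟨X, hX, hX0⟩ := 𝔨.exists_mem_ne_zero_of_ne_bot h0
    obtain ⟨a, b, c, rfl⟩ := mem_slAlg_iff.1 (hsl hX)
    have hE : tf 0 1 0 ∈ 𝔨 → tf 1 0 0 ∈ 𝔨 := fun h => by
      convert 𝔨.smul_mem (-1) (lie 0 0 1 h) using 1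
      simp
    -- If `c ≠ 0`, bracketing twice with `tf 0 1 0` leaves a multiple of `tf 0 1 0`; if `c = 0 ≠ b`,
    -- one bracket with `tf 1 0 0` does.
    by_cases hc : c = 0
    · subst hc
      by_cases hb : b = 0
      · subst hb
        have ha : a ≠ 0 := by rintro rfl; simp at hX0
        convert 𝔨.smul_mem a⁻¹ hX using 1
        simp [ha]
      · apply hE
        convert 𝔨.smul_mem (2 * b)⁻¹ (lie 1 0 0 hX) using 1
        simp [tf_inj]
        field_simp
    · apply hE
      convert 𝔨.smul_mem (-(2 * c)⁻¹) (lie 0 1 0 (lie 0 1 0 hX)) using 1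
      simp [tf_inj]
      field_simp
  have hE : tf 0 1 0 ∈ 𝔨 := by
    convert 𝔨.smul_mem (-2⁻¹ : ℝ) (lie 0 1 0 hH) using 1
    simp
  have hF : tf 0 0 1 ∈ 𝔨 := by
    convert 𝔨.smul_mem (2⁻¹ : ℝ) (lie 0 0 1 hH) using 1
    simp
  refine le_antisymm hsl fun X hX => ?_
  obtain ⟨a, b, c, rfl⟩ := mem_slAlg_iff.1 hX
  have := 𝔨.add_mem (𝔨.add_mem (𝔨.smul_mem a hH) (𝔨.smul_mem b hE)) (𝔨.smul_mem c hF)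
  simpa using this

/-! ### Subalgebras of `sl(2, ℝ) × sl(2, ℝ)` -/

/-- Rank-nullity for the first projection, whose kernel on `𝔤` is the intersection with the second
factor. -/
theorem finrank_eq_map_fst (𝔤 : Submodule ℝ (M2 × M2)) :
    Module.finrank ℝ 𝔤 = Module.finrank ℝ (𝔤.map (fst ℝ M2 M2))
      + Module.finrank ℝ (𝔤.comap (inr ℝ M2 M2)) := by
  rw [← finrank_range_add_finrank_ker ((fst ℝ M2 M2).domRestrict 𝔤), range_domRestrict]
  congr 1
  refine LinearEquiv.finrank_eq (LinearEquiv.ofBijective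
    (LinearMap.codRestrict _ (LinearMap.codRestrict 𝔤 (inr ℝ M2 M2 ∘ₗ Submodule.subtype _)
      fun Y => Y.2) fun Y => rfl) ⟨fun Y Z h => ?_, fun X => ?_⟩).symm
  · exact Subtype.ext (congrArg (fun Z => Z.1.1.2) h)
  · obtain ⟨⟨⟨X, Y⟩, hX⟩, rfl : X = 0⟩ := X
    exact ⟨⟨Y, hX⟩, rfl⟩

/-- `𝔤` is closed under the Lie bracket of `M(2, ℝ) × M(2, ℝ)`. -/
def LieClosed (𝔤 : Submodule ℝ (M2 × M2)) : Prop :=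
  ∀ X ∈ 𝔤, ∀ Y ∈ 𝔤, (X.1 * Y.1 - Y.1 * X.1, X.2 * Y.2 - Y.2 * X.2) ∈ 𝔤

/-- An infinitesimal version of `FixesPointEin12`. -/
def FixesNullLine (𝔤 : Submodule ℝ (M2 × M2)) : Prop :=
  ∃ (Z : M2) (r : ℝ), Z ≠ 0 ∧ Z.det = r ^ 2 ∧
    ∀ X ∈ 𝔤, ∃ c : ℝ, X.1 * Z - Z * X.2 = c • Z ∧ (r = 0 ∨ c = 0)

/-- An exponential scales `Z` by `e^c` but acts trivially on the summand `ℝ`; the line of `(Z, r)`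
is preserved because `r = 0` or `c = 0`. -/
theorem FixesNullLine.fixesPoint {𝔤 : Submodule ℝ (M2 × M2)} (h : FixesNullLine 𝔤) :
    FixesPointEin12 (expGroup 𝔤) := by
  obtain ⟨Z, r, hZ, hdet, h⟩ := h
  have hv : ((Z, r) : R23) ≠ 0 := fun hv => hZ (congrArg Prod.fst hv)
  refine ⟨Projectivization.mk ℝ (Z, r) hv, ?_, fun g hg => ?_⟩
  · intro v hv'
    rw [Projectivization.submodule_mk, Submodule.mem_span_singleton] at hv'
    obtain ⟨a, rfl⟩ := hv'
    simp [einForm, hdet]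
    ring
  · suffices hg : ∃ c : ℝ, c ≠ 0 ∧ rep g (Z, r) = c • (Z, r) by
      obtain ⟨c, hc, hg⟩ := hg
      rw [Projectivization.map_mk, Projectivization.mk_eq_mk_iff']
      exact ⟨c, hg.symm⟩
    refine Subgroup.closure_induction (p := fun g _ => ∃ c : ℝ, c ≠ 0 ∧ rep g (Z, r) = c • (Z, r))
      ?_ ⟨1, one_ne_zero, by simp⟩ ?_ ?_ hg
    · rintro ⟨A, B⟩ ⟨X, hX, h1, h2⟩
      obtain ⟨c, hc, hrc⟩ := h X hX
      refine ⟨Real.exp c, (Real.exp_pos c).ne', ?_⟩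
      have h3 := exp_mul_of_mul_sub hc
      rw [← h1, ← h2] at h3
      refine Prod.ext ?_ ?_
      · change (A : M2) * Z * ((B⁻¹ : SL2) : M2) = Real.exp c • Z
        rw [h3, smul_mul_assoc, mul_assoc, coe_mul_coe_inv, mul_one]
      · change r = Real.exp c * r
        rcases hrc with rfl | rfl <;> simp
    · rintro x y - - ⟨c, hc, hx⟩ ⟨d, hd, hy⟩
      refine ⟨c * d, mul_ne_zero hc hd, ?_⟩
      rw [map_mul, LinearEquiv.mul_apply, hy, map_smul, hx, smul_smul, mul_comm]
    · rintro x - ⟨c, hc, hx⟩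
      refine ⟨c⁻¹, inv_ne_zero hc, ?_⟩
      have hxx : rep x⁻¹ (rep x (Z, r)) = (Z, r) := by
        rw [← LinearEquiv.mul_apply, ← map_mul, inv_mul_cancel, map_one]
        rfl
      rw [hx, map_smul] at hxx
      rw [← hxx, smul_smul, inv_mul_cancel₀ hc, one_smul, hxx]

theorem FixesNullLine.of_conj {𝔤 : Submodule ℝ (M2 × M2)} {g : SL2 × SL2}
    (h : FixesNullLine (𝔤.map (conjLinProd g).toLinearMap)) : FixesNullLine 𝔤 := by
  obtain ⟨Z, r, hZ, hdet, h⟩ := h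
  obtain ⟨W, rfl⟩ : ∃ W, Z = (g.1 : M2) * W * ((g.2⁻¹ : SL2) : M2) :=
    ⟨((g.1⁻¹ : SL2) : M2) * Z * (g.2 : M2), by
      simp only [mul_assoc, coe_mul_coe_inv, mul_one]
      rw [← mul_assoc, coe_mul_coe_inv, one_mul]⟩
  refine ⟨W, r, ?_, ?_, fun X hX => ?_⟩
  · rintro rfl
    simp at hZ
  · rw [Matrix.det_mul, Matrix.det_mul, g.1.det_coe, (g.2⁻¹).det_coe, one_mul, mul_one] at hdet
    exact hdet
  · obtain ⟨c, hc, hr⟩ := h _ (Submodule.mem_map_of_mem hX)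
    refine ⟨c, ?_, hr⟩
    have h1 := congrArg (fun V => ((g.1⁻¹ : SL2) : M2) * V * (g.2 : M2)) hc
    have e1 : ∀ V : M2, ((g.1⁻¹ : SL2) : M2) * ((g.1 : M2) * V) = V := fun V => by
      rw [← mul_assoc, coe_inv_mul_coe, one_mul]
    have e2 : ∀ V : M2, ((g.2⁻¹ : SL2) : M2) * ((g.2 : M2) * V) = V := fun V => by
      rw [← mul_assoc, coe_inv_mul_coe, one_mul]
    change ((g.1⁻¹ : SL2) : M2) * (((g.1 : M2) * X.1 * ((g.1⁻¹ : SL2) : M2)) * _ -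
      _ * ((g.2 : M2) * X.2 * ((g.2⁻¹ : SL2) : M2))) * (g.2 : M2) = _ at h1
    simpa only [mul_sub, sub_mul, mul_assoc, e1, e2, coe_inv_mul_coe, mul_one, mul_smul_comm,
      smul_mul_assoc] using h1

/-! ### Goursat data: projections of `𝔤` and its intersections with the factors -/

section Projections

variable {𝔤 : Submodule ℝ (M2 × M2)}

theorem lie_mem_map_fst (h : LieClosed 𝔤) :
    ∀ X ∈ 𝔤.map (fst ℝ M2 M2), ∀ Y ∈ 𝔤.map (fst ℝ M2 M2),
      X * Y - Y * X ∈ 𝔤.map (fst ℝ M2 M2) := by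
  rintro _ ⟨X, hX, rfl⟩ _ ⟨Y, hY, rfl⟩
  exact ⟨_, h X hX Y hY, rfl⟩

theorem lie_mem_map_snd (h : LieClosed 𝔤) :
    ∀ X ∈ 𝔤.map (snd ℝ M2 M2), ∀ Y ∈ 𝔤.map (snd ℝ M2 M2),
      X * Y - Y * X ∈ 𝔤.map (snd ℝ M2 M2) := by
  rintro _ ⟨X, hX, rfl⟩ _ ⟨Y, hY, rfl⟩
  exact ⟨_, h X hX Y hY, rfl⟩

/-- The intersection with a factor is an ideal of the whole projection, which is what lets
simplicity of `sl(2, ℝ)` act. -/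
theorem lie_mem_comap_inl (h : LieClosed 𝔤) :
    ∀ X ∈ 𝔤.map (fst ℝ M2 M2), ∀ Y ∈ 𝔤.comap (inl ℝ M2 M2),
      X * Y - Y * X ∈ 𝔤.comap (inl ℝ M2 M2) := by
  rintro _ ⟨X, hX, rfl⟩ Y hY
  simpa using h X hX _ hY

theorem lie_mem_comap_inr (h : LieClosed 𝔤) :
    ∀ X ∈ 𝔤.map (snd ℝ M2 M2), ∀ Y ∈ 𝔤.comap (inr ℝ M2 M2),
      X * Y - Y * X ∈ 𝔤.comap (inr ℝ M2 M2) := by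
  rintro _ ⟨X, hX, rfl⟩ Y hY
  simpa using h X hX _ hY

theorem comap_inl_le : 𝔤.comap (inl ℝ M2 M2) ≤ 𝔤.map (fst ℝ M2 M2) := fun _ hX => ⟨_, hX, rfl⟩

theorem comap_inr_le : 𝔤.comap (inr ℝ M2 M2) ≤ 𝔤.map (snd ℝ M2 M2) := fun _ hX => ⟨_, hX, rfl⟩

theorem eq_prod_of_comap_inl (h : 𝔤.comap (inl ℝ M2 M2) = 𝔤.map (fst ℝ M2 M2)) :
    𝔤 = (𝔤.map (fst ℝ M2 M2)).prod (𝔤.map (snd ℝ M2 M2)) := by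
  refine le_antisymm (fun X hX => ⟨⟨X, hX, rfl⟩, ⟨X, hX, rfl⟩⟩) ?_
  rintro ⟨X, Y⟩ ⟨hX, ⟨⟨X', Y'⟩, hY, rfl : Y' = Y⟩⟩
  have h1 : (X - X', (0 : M2)) ∈ 𝔤 := by
    have : X - X' ∈ 𝔤.comap (inl ℝ M2 M2) := by
      rw [h]
      exact sub_mem hX ⟨_, hY, rfl⟩
    exact this
  simpa using add_mem h1 hY

theorem eq_prod_of_comap_inr (h : 𝔤.comap (inr ℝ M2 M2) = 𝔤.map (snd ℝ M2 M2)) :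
    𝔤 = (𝔤.map (fst ℝ M2 M2)).prod (𝔤.map (snd ℝ M2 M2)) := by
  refine le_antisymm (fun X hX => ⟨⟨X, hX, rfl⟩, ⟨X, hX, rfl⟩⟩) ?_
  rintro ⟨X, Y⟩ ⟨⟨⟨X', Y'⟩, hX, rfl : X' = X⟩, hY⟩
  have h1 : ((0 : M2), Y - Y') ∈ 𝔤 := by
    have : Y - Y' ∈ 𝔤.comap (inr ℝ M2 M2) := by
      rw [h]
      exact sub_mem hY ⟨_, hX, rfl⟩
    exact this
  simpa using add_mem h1 hX

/-- The second alternative leaves out the elliptic line because that product is listed only in the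
order `Y_E × SL(2, ℝ)`. -/
theorem listed_of_prod {Λ : Set ℝ} {𝔭 𝔮 : Submodule ℝ M2}
    (h : 𝔭 = Submodule.span ℝ {tf 0 1 (-1)} ∧ IsModel 𝔮 ∨
      𝔭 = slAlg ∧ IsModel 𝔮 ∧ 𝔮 ≠ Submodule.span ℝ {tf 0 1 (-1)}) :
    Listed Λ (expGroup (𝔭.prod 𝔮)) := by
  rw [expGroup_prod]
  rcases h with ⟨rfl, h⟩ | ⟨rfl, h, hne⟩
  · rw [closure_expSet_elliptic]
    cases h
    · rw [closure_expSet_elliptic]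
      exact .elliptic_elliptic
    · rw [closure_expSet_parabolic]
      exact .elliptic_parabolic
    · rw [closure_expSet_hyperbolic]
      exact .elliptic_hyperbolic
    · rw [closure_expSet_affine]
      exact .elliptic_affine
    · rw [closure_expSet_slAlg]
      exact .elliptic_full
  · rw [closure_expSet_slAlg]
    cases h
    · exact absurd rfl hne
    · rw [closure_expSet_parabolic]
      exact .full_parabolic
    · rw [closure_expSet_hyperbolic]
      exact .full_hyperbolic
    · rw [closure_expSet_affine]
      exact .full_affine
    · rw [closure_expSet_slAlg]
      exact .full_full

/-- If the first projection is elliptic, then `𝔤` is a product or the Lie algebra of some `𝒢_λ`. -/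
theorem listed_of_fst_elliptic (hlie : LieClosed 𝔤) (hdim : 2 ≤ Module.finrank ℝ 𝔤)
    (h1 : 𝔤.map (fst ℝ M2 M2) = Submodule.span ℝ {tf 0 1 (-1)})
    (h2 : IsModel (𝔤.map (snd ℝ M2 M2))) :
    Listed {lam : ℝ | lam ≠ 0} (expGroup 𝔤) := by
  by_cases hk : 𝔤.comap (inr ℝ M2 M2) = 𝔤.map (snd ℝ M2 M2)
  · rw [eq_prod_of_comap_inr hk]
    exact listed_of_prod (.inl ⟨h1, h2⟩)
  have hJ : tf 0 1 (-1) ≠ 0 := by simp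
  have hJ1 := finrank_span_singleton (K := ℝ) hJ
  have hdim' := finrank_eq_map_fst 𝔤
  rw [h1, hJ1] at hdim'
  -- The ideal in the second factor has dimension at least one and is proper, so the second
  -- projection is not a line.
  have hlt := Submodule.finrank_lt_finrank_of_lt (lt_of_le_of_ne comap_inr_le hk)
  have hmem : ∀ X ∈ 𝔤, ∃ t, X.1 = tf 0 t (-t) := fun X hX => by
    rw [← mem_span_elliptic_iff, ← h1]
    exact ⟨X, hX, rfl⟩
  -- Brackets have zero first component since `so(2)` is abelian.
  have hder : ∀ Y ∈ 𝔤.map (snd ℝ M2 M2), ∀ Y' ∈ 𝔤.map (snd ℝ M2 M2),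
      ((0 : M2), Y * Y' - Y' * Y) ∈ 𝔤 := by
    rintro _ ⟨X, hX, rfl⟩ _ ⟨X', hX', rfl⟩
    obtain ⟨t, ht⟩ := hmem X hX
    obtain ⟨t', ht'⟩ := hmem X' hX'
    have := hlie X hX X' hX'
    rw [ht, ht', tf_lie] at this
    convert this using 2
    · symm
      rw [tf_eq_zero]
      refine ⟨by ring, by ring, by ring⟩
    · rfl
  generalize h𝔮 : 𝔤.map (snd ℝ M2 M2) = 𝔮 at *
  cases h2 with
  | elliptic => rw [hJ1] at hlt; omega
  | parabolic =>
    rw [finrank_span_singleton (K := ℝ) (v := tf 0 1 0) (by simp)] at hlt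
    omega
  | hyperbolic =>
    rw [finrank_span_singleton (K := ℝ) (v := tf 1 0 0) (by simp)] at hlt
    omega
  | full =>
    refine absurd (eq_slAlg_of_ideal (𝔨 := 𝔤.comap (inr ℝ M2 M2)) ?_ ?_ ?_) hk
    · exact h𝔮 ▸ comap_inr_le
    · rintro h
      rw [h, finrank_bot] at hdim'
      omega
    · exact h𝔮 ▸ lie_mem_comap_inr hlie
  | affine =>
    have hE : ((0 : M2), tf 0 1 0) ∈ 𝔤 := by
      have := 𝔤.smul_mem (2⁻¹ : ℝ)
        (hder _ (mem_affAlg_iff.2 ⟨1, 0, rfl⟩) _ (mem_affAlg_iff.2 ⟨0, 1, rfl⟩))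
      simpa only [tf_lie, Prod.smul_mk, smul_zero, smul_tf, mul_one, mul_zero, zero_mul, sub_zero,
        inv_mul_cancel₀ (two_ne_zero' ℝ)] using this
    obtain ⟨⟨X, Y⟩, hH, hY : Y = _⟩ : tf 1 0 0 ∈ 𝔤.map (snd ℝ M2 M2) :=
      h𝔮.symm ▸ mem_affAlg_iff.2 ⟨1, 0, rfl⟩
    obtain ⟨lam, hX : X = _⟩ := hmem _ hH
    subst hX hY
    have hH0 : ((0 : M2), tf 1 0 0) ∉ 𝔤 := by
      intro hH0
      refine hk (le_antisymm (h𝔮 ▸ comap_inr_le) ?_)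
      rw [affAlg, Submodule.span_le]
      rintro _ (rfl | rfl)
      · exact hH0
      · exact hE
    have hlam : lam ≠ 0 := by
      rintro rfl
      exact hH0 (by simpa [tf_zero] using hH)
    have h𝔤 : 𝔤 = twistedAlg lam := by
      refine le_antisymm (fun X hX => ?_) ?_
      · obtain ⟨u, hu⟩ := hmem X hX
        obtain ⟨t, s, hts⟩ := mem_affAlg_iff.1 (h𝔮.le ⟨X, hX, rfl⟩)
        rw [mem_twistedAlg_iff]
        refine ⟨t, s, Prod.ext ?_ hts⟩
        obtain rfl : X = (tf 0 u (-u), tf t s 0) := Prod.ext hu hts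
        by_contra hne
        have hne' : u - lam * t ≠ 0 := fun h => hne (by rw [sub_eq_zero.1 h])
        -- `h3` puts a nonzero multiple of `(tf 0 1 (-1), 0)` in `𝔤`; removing the rotation part of
        -- `hH` with it would give `(0, tf 1 0 0) ∈ 𝔤`.
        have h3 := sub_mem (sub_mem hX (𝔤.smul_mem t hH)) (𝔤.smul_mem s hE)
        have h4 := sub_mem hH (𝔤.smul_mem (lam * (u - lam * t)⁻¹) h3)
        apply hH0
        convert h4 using 1
        refine Prod.ext ?_ ?_
        · simp
          rw [eq_comm, tf_eq_zero]
          refine ⟨rfl, ?_, ?_⟩ <;> field_simp <;> ring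
        · simp
      · rw [twistedAlg, Submodule.span_le]
        rintro _ (rfl | rfl)
        · exact hH
        · exact hE
    rw [h𝔤, expGroup_twistedAlg]
    exact .twisted lam hlam

end Projections

/-! ### Graphs of automorphisms -/

/-- A nontrivial two-dimensional representation of `sl(2, ℝ)` is equivalent to the standard one. -/
theorem exists_intertwiner {e f : M2} (he0 : e ≠ 0) (he : e.trace = 0) (hf : f.trace = 0)
    (h1 : (e * f - f * e) * e - e * (e * f - f * e) = (2 : ℝ) • e)
    (h2 : (e * f - f * e) * f - f * (e * f - f * e) = (-2 : ℝ) • f) :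
    ∃ D : M2, D.det ≠ 0 ∧ e * D = D * tf 0 1 0 ∧ f * D = D * tf 0 0 1 := by
  have sq0 : ∀ {a b c : ℝ}, a ^ 2 + b * c = 0 → tf a b c * tf a b c = 0 := by
    intro a b c h
    ext i j
    fin_cases i <;> fin_cases j <;> simp [tf, Matrix.mul_apply, Fin.sum_univ_two] <;>
      first | ring1 | linear_combination h
  obtain ⟨p, q, r, rfl⟩ : ∃ p q r, e = tf p q r := ⟨_, _, _, eq_tf_of_trace he⟩
  obtain ⟨p', q', r', rfl⟩ : ∃ p q r, f = tf p q r := ⟨_, _, _, eq_tf_of_trace hf⟩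
  -- From `[h, e] = 2e` with `h = [e, f]`, `2 tr(e²) = tr([h, e] e) = 0`; similarly for `f`.
  have hee : tf p q r * tf p q r = 0 := by
    rw [tf_lie, tf_lie, smul_tf, tf_inj] at h1
    obtain ⟨h1, h2, h3⟩ := h1
    exact sq0 (by linear_combination (-p / 2) * h1 - (r / 4) * h2 - (q / 4) * h3)
  have hff : tf p' q' r' * tf p' q' r' = 0 := by
    rw [tf_lie, tf_lie, smul_tf, tf_inj] at h2
    obtain ⟨h1, h2, h3⟩ := h2
    exact sq0 (by linear_combination (p' / 2) * h1 + (r' / 4) * h2 + (q' / 4) * h3)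
  set e := tf p q r with hedef
  set f := tf p' q' r'
  have hefe : e * f * e = e := by
    have : (e * f - f * e) * e - e * (e * f - f * e)
        = (2 : ℝ) • (e * f * e) - f * (e * e) - e * e * f := by
      rw [two_smul]
      noncomm_ring
    rw [this, hee, mul_zero, zero_mul, sub_zero, sub_zero] at h1
    exact smul_right_injective M2 (two_ne_zero' ℝ) h1
  obtain ⟨u, v, huv⟩ : ∃ u v : ℝ, p * u + q * v ≠ 0 ∨ r * u - p * v ≠ 0 := by
    by_contra! h
    have hq := h 0 1
    have hr := h 1 0
    apply he0
    rw [hedef, tf_eq_zero]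
    simp at hq hr
    tauto
  -- With `w = (u, v)` and `e w ≠ 0`, the intertwiner `e * W₁ + f * e * W₂` has columns `e w` and `f
  -- e w`: a highest weight vector and its image under `f`.
  set W₁ : M2 := !![u, 0; v, 0] with hW₁
  set W₂ : M2 := !![0, u; 0, v] with hW₂
  have w1 : W₁ * tf 0 1 0 = W₂ := by
    ext i j; fin_cases i <;> fin_cases j <;> simp [tf, W₁, W₂]
  have w2 : W₂ * tf 0 1 0 = 0 := by
    ext i j; fin_cases i <;> fin_cases j <;> simp [tf, W₂]
  have w3 : W₁ * tf 0 0 1 = 0 := by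
    ext i j; fin_cases i <;> fin_cases j <;> simp [tf, W₁]
  have w4 : W₂ * tf 0 0 1 = W₁ := by
    ext i j; fin_cases i <;> fin_cases j <;> simp [tf, W₁, W₂]
  have heD : e * (e * W₁ + f * e * W₂) = (e * W₁ + f * e * W₂) * tf 0 1 0 := by
    rw [mul_add, add_mul, ← mul_assoc, hee, zero_mul, zero_add, ← mul_assoc, ← mul_assoc, hefe,
      mul_assoc, mul_assoc, w1, w2, mul_zero, add_zero]
  have hfD : f * (e * W₁ + f * e * W₂) = (e * W₁ + f * e * W₂) * tf 0 0 1 := by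
    rw [mul_add, add_mul, mul_assoc f e W₂, ← mul_assoc f f, hff, zero_mul, add_zero,
      mul_assoc e W₁, w3, mul_zero, zero_add, mul_assoc, mul_assoc, w4]
  have hD0 : p * u + q * v = (e * W₁ + f * e * W₂) 0 0 := by
    simp [e, tf, W₁, W₂, Matrix.mul_apply, Fin.sum_univ_two]
  have hD1 : r * u - p * v = (e * W₁ + f * e * W₂) 1 0 := by
    simp [e, tf, W₁, W₂, Matrix.mul_apply, Fin.sum_univ_two]
    ring
  rw [hD0, hD1] at huv
  generalize e * W₁ + f * e * W₂ = D at *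
  refine ⟨D, fun hdet => ?_, heD, hfD⟩
  -- `e` kills the first column of `D` and maps the second to the first, so dependent columns would
  -- force the first to vanish.
  rw [Matrix.det_fin_two] at hdet
  have k1 := congrFun (congrFun heD 0) 0
  have k2 := congrFun (congrFun heD 0) 1
  have k3 := congrFun (congrFun heD 1) 0
  have k4 := congrFun (congrFun heD 1) 1
  simp [e, tf, Matrix.mul_apply, Fin.sum_univ_two] at k1 k2 k3 k4
  rcases huv with h | h <;> apply h <;> rw [← sq_eq_zero_iff]
  · linear_combination (-(D 0 0)) * k2 + q * hdet + D 0 1 * k1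
  · linear_combination (-(D 1 0)) * k4 - r * hdet + D 1 1 * k3

/-- The Lie algebra automorphism group of `sl(2, ℝ)` consists of conjugations by elements of
`GL(2, ℝ)`; here `𝔤` is the graph of an automorphism. -/
theorem exists_conj_of_graph {𝔤 : Submodule ℝ (M2 × M2)} (hlie : LieClosed 𝔤)
    (h1 : 𝔤.map (fst ℝ M2 M2) = slAlg) (h2 : 𝔤.map (snd ℝ M2 M2) = slAlg)
    (hk1 : 𝔤.comap (inl ℝ M2 M2) = ⊥) (hk2 : 𝔤.comap (inr ℝ M2 M2) = ⊥) :
    ∃ D : M2, D.det ≠ 0 ∧ ∀ X ∈ 𝔤, X.2 * D = D * X.1 := by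
  have tr1 : ∀ X ∈ 𝔤, X.1 ∈ slAlg := fun X hX => h1.le ⟨X, hX, rfl⟩
  have tr2 : ∀ X ∈ 𝔤, X.2.trace = 0 := fun X hX => h2.le ⟨X, hX, rfl⟩
  have inj2 : ∀ {X Y Y'}, (X, Y) ∈ 𝔤 → (X, Y') ∈ 𝔤 → Y = Y' := by
    intro X Y Y' hY hY'
    have : Y - Y' ∈ 𝔤.comap (inr ℝ M2 M2) := by simpa using sub_mem hY hY'
    rw [hk2, Submodule.mem_bot, sub_eq_zero] at this
    exact this
  obtain ⟨⟨E, e⟩, he, hE : E = _⟩ : tf 0 1 0 ∈ 𝔤.map (fst ℝ M2 M2) := h1 ▸ tf_mem_slAlg 0 1 0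
  obtain ⟨⟨F, f⟩, hf, hF : F = _⟩ : tf 0 0 1 ∈ 𝔤.map (fst ℝ M2 M2) := h1 ▸ tf_mem_slAlg 0 0 1
  subst hE hF
  -- The second component is determined by the first, so `e` and `f` inherit the `sl(2)` relations
  -- of `tf 0 1 0` and `tf 0 0 1`.
  have hh := hlie _ he _ hf
  have hhe := hlie _ hh _ he
  have hhf := hlie _ hh _ hf
  have he0 : e ≠ 0 := by
    rintro rfl
    have : tf 0 1 0 ∈ 𝔤.comap (inl ℝ M2 M2) := he
    rw [hk1, Submodule.mem_bot] at this
    simp at this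
  obtain ⟨D, hD, hDe, hDf⟩ := exists_intertwiner he0 (tr2 _ he) (tr2 _ hf)
    (inj2 hhe (by
      convert 𝔤.smul_mem 2 he using 1
      simp))
    (inj2 hhf (by
      convert 𝔤.smul_mem (-2) hf using 1
      simp))
  refine ⟨D, hD, ?_⟩
  rintro ⟨X, Y⟩ hX
  obtain ⟨a, b, c, rfl : X = _⟩ := mem_slAlg_iff.1 (tr1 _ hX)
  have hY : Y = a • (e * f - f * e) + b • e + c • f := by
    refine inj2 hX ?_
    convert add_mem (add_mem (𝔤.smul_mem a hh) (𝔤.smul_mem b he)) (𝔤.smul_mem c hf) using 1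
    simp
  have hX : tf a b c
      = a • (tf 0 1 0 * tf 0 0 1 - tf 0 0 1 * tf 0 1 0) + b • tf 0 1 0 + c • tf 0 0 1 := by
    simp
  change Y * D = D * tf a b c
  rw [hY, hX]
  simp only [add_mul, mul_add, sub_mul, mul_sub, smul_mul_assoc, mul_smul_comm, mul_assoc, hDe, hDf]
  simp only [← mul_assoc, hDe, hDf]

/-- Conjugation by an invertible matrix, as a Lie group automorphism of `SL(2, ℝ)`. -/
def conjEquiv (D D' : M2) (h : D * D' = 1) : SL2 ≃ₜ* SL2 where
  toFun A := ⟨D * A * D', by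
    rw [Matrix.det_mul, mul_comm, ← Matrix.det_mul, ← mul_assoc, mul_eq_one_comm.1 h, one_mul,
      A.det_coe]⟩
  invFun A := ⟨D' * A * D, by
    rw [Matrix.det_mul, mul_comm, ← Matrix.det_mul, ← mul_assoc, h, one_mul, A.det_coe]⟩
  left_inv A := Subtype.ext (by
    change D' * (D * A * D') * D = A
    simp only [mul_assoc, mul_eq_one_comm.1 h, mul_one]
    rw [← mul_assoc, mul_eq_one_comm.1 h, one_mul])
  right_inv A := Subtype.ext (by
    change D * (D' * A * D) * D' = A
    simp only [mul_assoc, h, mul_one]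
    rw [← mul_assoc, h, one_mul])
  map_mul' A B := Subtype.ext (by
    change D * ((A * B : SL2) : M2) * D' = (D * A * D') * (D * B * D')
    rw [Matrix.SpecialLinearGroup.coe_mul]
    simp only [mul_assoc]
    rw [← mul_assoc D' D, mul_eq_one_comm.1 h, one_mul])
  continuous_toFun := by
    refine Continuous.subtype_mk ?_ _
    exact (continuous_const.mul continuous_subtype_val).mul continuous_const
  continuous_invFun := by
    refine Continuous.subtype_mk ?_ _
    exact (continuous_const.mul continuous_subtype_val).mul continuous_const

theorem coe_conjEquiv {D D' : M2} (h : D * D' = 1) (A : SL2) :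
    (conjEquiv D D' h A : M2) = D * A * D' := rfl

/-- Otherwise `B⁻¹ D` would commute with `SL(2, ℝ)`, hence be scalar with nonnegative determinant.
Two unipotents suffice to test this. -/
theorem conjEquiv_ne_conj {D D' : M2} (h : D * D' = 1) (hdet : D.det < 0) (B : SL2) :
    ∃ A : SL2, conjEquiv D D' h A ≠ B * A * B⁻¹ := by
  by_contra! hcon
  set C : M2 := ((B⁻¹ : SL2) : M2) * D with hC
  have comm : ∀ A : SL2, C * A = A * C := by
    intro A
    have h1 := congrArg (fun V : SL2 => ((B⁻¹ : SL2) : M2) * (V : M2) * D) (hcon A)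
    simp only [coe_conjEquiv, Matrix.SpecialLinearGroup.coe_mul, mul_assoc,
      mul_eq_one_comm.1 h, mul_one] at h1
    rw [← mul_assoc _ (B : M2), coe_inv_mul_coe, one_mul] at h1
    rw [hC, mul_assoc, h1]
  have hCdet : C.det = D.det := by rw [hC, Matrix.det_mul, (B⁻¹).det_coe, one_mul]
  have a1 := comm (tri 0 1)
  have a2 := comm (lowerUnip 1)
  have b1 := congrFun (congrFun a1 0) 0
  have b2 := congrFun (congrFun a1 0) 1
  have b3 := congrFun (congrFun a2 0) 0
  simp [coe_tri, lowerUnip, Matrix.mul_apply, Fin.sum_univ_two] at b1 b2 b3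
  have b4 : C 0 0 = C 1 1 := by linarith
  rw [← hCdet, Matrix.det_fin_two, b1, b3, b4] at hdet
  nlinarith [mul_self_nonneg (C 1 1)]

/-- The relation exponentiates, so the generators of `expGroup 𝔤` are the graph over the
exponentials of `sl(2, ℝ)`, which generate `SL(2, ℝ)`. -/
theorem expGroup_eq_graph {𝔤 : Submodule ℝ (M2 × M2)} (h1 : 𝔤.map (fst ℝ M2 M2) = slAlg)
    {D D' : M2} (h : D * D' = 1) (h𝔤 : ∀ X ∈ 𝔤, X.2 * D = D * X.1) :
    expGroup 𝔤 = (conjEquiv D D' h).toMulEquiv.toMonoidHom.graph := by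
  have h2 : ∀ X ∈ 𝔤, exp X.2 = D * exp X.1 * D' := by
    intro X hX
    rw [mul_exp_of_mul_eq (h𝔤 X hX).symm, mul_assoc, h, mul_one]
  rw [MonoidHom.graph_eq_range_prod, MonoidHom.range_eq_map, ← closure_expSet_slAlg,
    MonoidHom.map_closure, expGroup]
  congr 1
  ext ⟨A, B⟩
  constructor
  · rintro ⟨X, hX, hA, hB⟩
    refine ⟨A, ⟨X.1, h1.le ⟨X, hX, rfl⟩, hA⟩, Prod.ext rfl (Subtype.ext ?_)⟩
    change D * (A : M2) * D' = B
    rw [hA, hB, h2 X hX]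
  · rintro ⟨A, ⟨X, hX, hA⟩, hAB⟩
    obtain ⟨rfl, rfl⟩ := Prod.ext_iff.1 hAB
    obtain ⟨Y, hY, rfl⟩ := h1.ge hX
    refine ⟨Y, hY, hA, ?_⟩
    change D * (A : M2) * D' = _
    rw [hA, h2 Y hY]
    rfl

theorem listed_of_full {Λ : Set ℝ} {𝔤 : Submodule ℝ (M2 × M2)} (hlie : LieClosed 𝔤)
    (hfix : ¬ FixesNullLine 𝔤) (h1 : 𝔤.map (fst ℝ M2 M2) = slAlg)
    (h2 : 𝔤.map (snd ℝ M2 M2) = slAlg) : Listed Λ (expGroup 𝔤) := by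
  have hprod : 𝔤 = slAlg.prod slAlg → Listed Λ (expGroup 𝔤) := by
    rintro rfl
    refine listed_of_prod (.inr ⟨rfl, .full, fun h => ?_⟩)
    have h3 := finrank_slAlg
    rw [h, finrank_span_singleton (by simp)] at h3
    omega
  by_cases hk1 : 𝔤.comap (inl ℝ M2 M2) = ⊥
  swap
  · have := eq_slAlg_of_ideal (comap_inl_le.trans h1.le) hk1 (h1 ▸ lie_mem_comap_inl hlie)
    have := eq_prod_of_comap_inl (this.trans h1.symm)
    rw [h1, h2] at this
    exact hprod this
  by_cases hk2 : 𝔤.comap (inr ℝ M2 M2) = ⊥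
  swap
  · have := eq_slAlg_of_ideal (comap_inr_le.trans h2.le) hk2 (h2 ▸ lie_mem_comap_inr hlie)
    have := eq_prod_of_comap_inr (this.trans h2.symm)
    rw [h1, h2] at this
    exact hprod this
  obtain ⟨D, hD, h𝔤⟩ := exists_conj_of_graph hlie h1 h2 hk1 hk2
  have hinv : D * (D.det⁻¹ • D.adjugate) = 1 := by
    rw [mul_smul_comm, Matrix.mul_adjugate, smul_smul, inv_mul_cancel₀ hD, one_smul]
  rcases hD.lt_or_gt with hneg | hpos
  · rw [expGroup_eq_graph h1 hinv h𝔤]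
    exact .graph _ (conjEquiv_ne_conj hinv hneg)
  -- `Y D = D X` gives `X (adj D) = (adj D) Y`, so `(adj D, √det D)` is a null vector annihilated by
  -- `𝔤`.
  · have hadj : D.adjugate.det = D.det := by simp [Matrix.det_adjugate]
    refine absurd ⟨D.adjugate, √D.det, ?_, ?_, fun X hX => ⟨0, ?_, .inr rfl⟩⟩ hfix
    · rintro h
      rw [h, Matrix.det_zero] at hadj
      exact hD hadj.symm
    · rw [hadj, Real.sq_sqrt hpos.le]
    · rw [zero_smul, sub_eq_zero]
      have h3 := congrArg (fun V => D.adjugate * V * D.adjugate) (h𝔤 X hX)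
      simp only [mul_assoc, Matrix.mul_adjugate] at h3
      rw [← mul_assoc _ D, Matrix.adjugate_mul] at h3
      simp only [mul_smul_comm, mul_one, smul_mul_assoc, one_mul] at h3
      exact (smul_right_injective M2 hD h3).symm

/-- If `𝔤` met the first factor trivially, it would embed in a second projection of dimension less
than 3 while mapping onto `sl(2, ℝ)`. -/
theorem listed_of_fst_full {Λ : Set ℝ} {𝔤 : Submodule ℝ (M2 × M2)} (hlie : LieClosed 𝔤)
    (h1 : 𝔤.map (fst ℝ M2 M2) = slAlg) (h2 : IsModel (𝔤.map (snd ℝ M2 M2)))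
    (hne : 𝔤.map (snd ℝ M2 M2) ≠ Submodule.span ℝ {tf 0 1 (-1)})
    (hlt : Module.finrank ℝ (𝔤.map (snd ℝ M2 M2)) < 3) : Listed Λ (expGroup 𝔤) := by
  suffices hk : 𝔤.comap (inl ℝ M2 M2) ≠ ⊥ by
    have hk1 := eq_slAlg_of_ideal (comap_inl_le.trans h1.le) hk (h1 ▸ lie_mem_comap_inl hlie)
    rw [eq_prod_of_comap_inl (hk1.trans h1.symm)]
    exact listed_of_prod (.inr ⟨h1, h2, hne⟩)
  intro hk
  have hinj : Function.Injective ((snd ℝ M2 M2).domRestrict 𝔤) := by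
    rw [injective_iff_map_eq_zero]
    rintro ⟨⟨X, Y⟩, hX⟩ (rfl : Y = 0)
    have : X ∈ 𝔤.comap (inl ℝ M2 M2) := hX
    rw [hk, Submodule.mem_bot] at this
    subst this
    rfl
  have h3 := finrank_range_of_inj hinj
  rw [range_domRestrict] at h3
  have h4 := finrank_eq_map_fst 𝔤
  rw [h1, finrank_slAlg] at h4
  omega

/-- `tf 0 1 0` has both image and kernel equal to the line of `e₁`, which upper triangular matrices
preserve. -/
theorem FixesNullLine.of_le_affAlg {𝔤 : Submodule ℝ (M2 × M2)}
    (h1 : 𝔤.map (fst ℝ M2 M2) ≤ affAlg) (h2 : 𝔤.map (snd ℝ M2 M2) ≤ affAlg) :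
    FixesNullLine 𝔤 := by
  refine ⟨tf 0 1 0, 0, by simp, by simp [tf], ?_⟩
  rintro ⟨X, Y⟩ hX
  obtain ⟨a, b, rfl : X = _⟩ := mem_affAlg_iff.1 (h1 ⟨_, hX, rfl⟩)
  obtain ⟨a', b', rfl : Y = _⟩ := mem_affAlg_iff.1 (h2 ⟨_, hX, rfl⟩)
  refine ⟨a + a', ?_, .inl rfl⟩
  ext i j
  fin_cases i <;> fin_cases j <;> simp [tf]

/-- The Lie algebra `𝔤` with its two factors exchanged. -/
abbrev swapAlg (𝔤 : Submodule ℝ (M2 × M2)) : Submodule ℝ (M2 × M2) :=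
  𝔤.map (LinearEquiv.prodComm ℝ M2 M2).toLinearMap

theorem mem_swapAlg_iff {𝔤 : Submodule ℝ (M2 × M2)} {X : M2 × M2} :
    X ∈ swapAlg 𝔤 ↔ X.swap ∈ 𝔤 := by
  constructor
  · rintro ⟨Y, hY, rfl⟩
    exact hY
  · intro h
    exact ⟨_, h, rfl⟩

theorem LieClosed.swap {𝔤 : Submodule ℝ (M2 × M2)} (h : LieClosed 𝔤) : LieClosed (swapAlg 𝔤) := by
  intro X hX Y hY
  rw [mem_swapAlg_iff] at *
  exact h _ hX _ hY

theorem LieClosed.conj {𝔤 : Submodule ℝ (M2 × M2)} (h : LieClosed 𝔤) (g : SL2 × SL2) :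
    LieClosed (𝔤.map (conjLinProd g).toLinearMap) := by
  rintro _ ⟨X, hX, rfl⟩ _ ⟨Y, hY, rfl⟩
  refine ⟨_, h X hX Y hY, ?_⟩
  change conjLinProd g _ = ((conjLinProd g X).1 * (conjLinProd g Y).1
    - (conjLinProd g Y).1 * (conjLinProd g X).1, (conjLinProd g X).2 * (conjLinProd g Y).2
    - (conjLinProd g Y).2 * (conjLinProd g X).2)
  simp only [conjLinProd_apply, map_sub, conjLin_mul]

theorem map_fst_swapAlg (𝔤 : Submodule ℝ (M2 × M2)) :
    (swapAlg 𝔤).map (fst ℝ M2 M2) = 𝔤.map (snd ℝ M2 M2) := by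
  rw [swapAlg, ← Submodule.map_comp]
  rfl

theorem map_snd_swapAlg (𝔤 : Submodule ℝ (M2 × M2)) :
    (swapAlg 𝔤).map (snd ℝ M2 M2) = 𝔤.map (fst ℝ M2 M2) := by
  rw [swapAlg, ← Submodule.map_comp]
  rfl

theorem map_fst_conj (𝔤 : Submodule ℝ (M2 × M2)) (g : SL2 × SL2) :
    (𝔤.map (conjLinProd g).toLinearMap).map (fst ℝ M2 M2)
      = (𝔤.map (fst ℝ M2 M2)).map (conjLin g.1).toLinearMap := by
  rw [← Submodule.map_comp, ← Submodule.map_comp]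
  rfl

theorem map_snd_conj (𝔤 : Submodule ℝ (M2 × M2)) (g : SL2 × SL2) :
    (𝔤.map (conjLinProd g).toLinearMap).map (snd ℝ M2 M2)
      = (𝔤.map (snd ℝ M2 M2)).map (conjLin g.2).toLinearMap := by
  rw [← Submodule.map_comp, ← Submodule.map_comp]
  rfl

theorem swapAlg_conj (𝔤 : Submodule ℝ (M2 × M2)) (g : SL2 × SL2) :
    swapAlg (𝔤.map (conjLinProd g).toLinearMap)
      = (swapAlg 𝔤).map (conjLinProd g.swap).toLinearMap := by
  rw [swapAlg, swapAlg, ← Submodule.map_comp, ← Submodule.map_comp]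
  rfl

theorem IsModel.trichotomy {𝔭 : Submodule ℝ M2} (h : IsModel 𝔭) :
    𝔭 = Submodule.span ℝ {tf 0 1 (-1)} ∨ 𝔭 = slAlg ∨
      (𝔭 ≤ affAlg ∧ 𝔭 ≠ Submodule.span ℝ {tf 0 1 (-1)}) := by
  have key : ∀ {𝔮 : Submodule ℝ M2}, 𝔮 ≤ affAlg → 𝔮 ≠ Submodule.span ℝ {tf 0 1 (-1)} := by
    rintro _ h rfl
    obtain ⟨a, b, hab⟩ := mem_affAlg_iff.1 (h (Submodule.mem_span_singleton_self _))
    simp [tf_inj] at hab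
  have hP : Submodule.span ℝ {tf 0 1 0} ≤ affAlg := Submodule.span_mono (by simp)
  have hH : Submodule.span ℝ {tf 1 0 0} ≤ affAlg := Submodule.span_mono (by simp)
  cases h with
  | elliptic => exact .inl rfl
  | full => exact .inr (.inl rfl)
  | parabolic => exact .inr (.inr ⟨hP, key hP⟩)
  | hyperbolic => exact .inr (.inr ⟨hH, key hH⟩)
  | affine => exact .inr (.inr ⟨le_rfl, key le_rfl⟩)

/-- The swap is needed when only the second projection is elliptic, or when the second is full and
the first upper triangular. -/
theorem listed_or_listed_swap {𝔤 : Submodule ℝ (M2 × M2)} (hlie : LieClosed 𝔤)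
    (hdim : 2 ≤ Module.finrank ℝ 𝔤) (hfix : ¬ FixesNullLine 𝔤)
    (h1 : IsModel (𝔤.map (fst ℝ M2 M2))) (h2 : IsModel (𝔤.map (snd ℝ M2 M2))) :
    Listed {lam : ℝ | lam ≠ 0} (expGroup 𝔤) ∨
      Listed {lam : ℝ | lam ≠ 0} (expGroup (swapAlg 𝔤)) := by
  have hlt : ∀ {𝔭 : Submodule ℝ M2}, 𝔭 ≤ affAlg → Module.finrank ℝ 𝔭 < 3 := fun h => by
    have := Submodule.finrank_mono h
    rw [finrank_affAlg] at this
    omega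
  have s1 := map_fst_swapAlg 𝔤
  have s2 := map_snd_swapAlg 𝔤
  rcases h1.trichotomy with e1 | e1 | ⟨e1, n1⟩
  · exact .inl (listed_of_fst_elliptic hlie hdim e1 h2)
  all_goals rcases h2.trichotomy with e2 | e2 | ⟨e2, n2⟩
  · exact .inr (listed_of_fst_elliptic hlie.swap (by rwa [LinearEquiv.finrank_map_eq])
      (s1.trans e2) (s2.symm ▸ h1))
  · exact .inl (listed_of_full hlie hfix e1 e2)
  · exact .inl (listed_of_fst_full hlie e1 h2 n2 (hlt e2))
  · exact .inr (listed_of_fst_elliptic hlie.swap (by rwa [LinearEquiv.finrank_map_eq])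
      (s1.trans e2) (s2.symm ▸ h1))
  · exact .inr (listed_of_fst_full hlie.swap (s1.trans e2) (s2.symm ▸ h1) (s2.symm ▸ n1)
      (s2.symm ▸ hlt e1))
  · exact absurd (.of_le_affAlg e1 e2) hfix

/-! ### Conjugacy by isometries -/

theorem ConjInSL.conjInConf {H K : Subgroup (SL2 × SL2)} (h : ConjInSL H K) : ConjInConf H K := by
  obtain ⟨g, rfl⟩ := h
  refine ⟨rep g, einForm_rep g, ?_⟩
  rw [Subgroup.map_map, Subgroup.map_map]
  congr 1
  ext1 x
  change rep g * rep x * (rep g)⁻¹ = rep (g * x * g⁻¹)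
  rw [map_mul, map_mul, map_inv]

theorem ConjInConf.trans {H K L : Subgroup (SL2 × SL2)} (h : ConjInConf H K)
    (h' : ConjInConf K L) : ConjInConf H L := by
  obtain ⟨F, hF, hHK⟩ := h
  obtain ⟨F', hF', hKL⟩ := h'
  refine ⟨F' * F, fun v => by rw [LinearEquiv.mul_apply, hF', hF], ?_⟩
  rw [← hKL, ← hHK, Subgroup.map_map _ (MulAut.conj F').toMonoidHom, map_mul]
  rfl

/-- The isometry of `ℝ^{2,3}` induced by conjugation by `diag(1, -1)`. -/
def flipIsometry : R23 ≃ₗ[ℝ] R23 where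
  toFun v := (!![1, 0; 0, -1] * v.1 * !![1, 0; 0, -1], v.2)
  invFun v := (!![1, 0; 0, -1] * v.1 * !![1, 0; 0, -1], v.2)
  map_add' v w := Prod.ext (by simp only [Prod.fst_add, mul_add, add_mul]) rfl
  map_smul' c v := Prod.ext (by simp only [Prod.smul_fst, mul_smul_comm, smul_mul_assoc]; rfl) rfl
  left_inv v := by
    refine Prod.ext ?_ rfl
    ext i j; fin_cases i <;> fin_cases j <;>
      simp [Matrix.mul_apply, Matrix.vecMul_eq_sum, Fin.sum_univ_two]
  right_inv v := by
    refine Prod.ext ?_ rfl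
    ext i j; fin_cases i <;> fin_cases j <;>
      simp [Matrix.mul_apply, Matrix.vecMul_eq_sum, Fin.sum_univ_two]

theorem flipIsometry_apply (v : R23) :
    flipIsometry v = (!![1, 0; 0, -1] * v.1 * !![1, 0; 0, -1], v.2) := rfl

theorem einForm_flipIsometry (v : R23) : einForm (flipIsometry v) = einForm v := by
  rw [flipIsometry_apply, einForm, einForm, Matrix.det_mul, Matrix.det_mul, Matrix.det_fin_two_of]
  ring

/-- Conjugation by `diag(1, -1)` reverses rotations but fixes the diagonal of `tri t s`, so `t` is
kept and `λ` changes sign. -/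
theorem conj_flipIsometry_rep (a t s : ℝ) :
    flipIsometry * rep (rot a, tri t s) * flipIsometry⁻¹ = rep (rot (-a), tri t (-s)) := by
  rw [mul_inv_eq_iff_eq_mul]
  refine LinearEquiv.ext fun v => Prod.ext ?_ rfl
  change !![1, 0; 0, -1] * ((rot a : M2) * v.1 * (((tri t s)⁻¹ : SL2) : M2)) * !![1, 0; 0, -1]
    = (rot (-a) : M2) * (!![1, 0; 0, -1] * v.1 * !![1, 0; 0, -1])
      * (((tri t (-s))⁻¹ : SL2) : M2)
  rw [tri_inv, tri_inv, coe_rot, coe_rot, coe_tri, coe_tri]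
  ext i j
  fin_cases i <;> fin_cases j <;>
    simp [Matrix.mul_apply, Matrix.vecMul_eq_sum, Fin.sum_univ_two] <;> ring

theorem conjInConf_twistedGroup_neg (lam : ℝ) :
    ConjInConf (twistedGroup lam) (twistedGroup (-lam)) := by
  refine ⟨flipIsometry, einForm_flipIsometry, ?_⟩
  ext x
  constructor
  · rintro ⟨_, ⟨_, ⟨t, s, rfl⟩, rfl⟩, rfl⟩
    exact ⟨_, ⟨t, -s, by rw [neg_mul]⟩, (conj_flipIsometry_rep _ _ _).symm⟩
  · rintro ⟨_, ⟨t, s, rfl⟩, rfl⟩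
    refine ⟨_, ⟨_, ⟨t, -s, rfl⟩, rfl⟩, (conj_flipIsometry_rep _ _ _).trans ?_⟩
    rw [neg_neg, neg_mul]

theorem exists_listed_pos {H K : Subgroup (SL2 × SL2)} (hK : Listed {lam : ℝ | lam ≠ 0} K)
    (h : ConjInSL H K) : ∃ K, Listed {lam : ℝ | 0 < lam} K ∧ ConjInConf H K := by
  have h := h.conjInConf
  cases hK with
  | elliptic_parabolic => exact ⟨_, .elliptic_parabolic, h⟩
  | elliptic_hyperbolic => exact ⟨_, .elliptic_hyperbolic, h⟩
  | elliptic_elliptic => exact ⟨_, .elliptic_elliptic, h⟩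
  | twisted lam hlam =>
    rcases lt_or_gt_of_ne hlam with h0 | h0
    · exact ⟨_, .twisted (-lam) (neg_pos.2 h0), h.trans (conjInConf_twistedGroup_neg lam)⟩
    · exact ⟨_, .twisted lam h0, h⟩
  | elliptic_affine => exact ⟨_, .elliptic_affine, h⟩
  | elliptic_full => exact ⟨_, .elliptic_full, h⟩
  | graph φ hφ => exact ⟨_, .graph φ hφ, h⟩
  | full_hyperbolic => exact ⟨_, .full_hyperbolic, h⟩
  | full_parabolic => exact ⟨_, .full_parabolic, h⟩
  | full_affine => exact ⟨_, .full_affine, h⟩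
  | full_full => exact ⟨_, .full_full, h⟩

/-! ### Nontrivial projections and the classification -/

theorem map_fst_ne_bot {𝔤 : Submodule ℝ (M2 × M2)}
    (h : (expGroup 𝔤).map (MonoidHom.fst SL2 SL2) ≠ ⊥) : 𝔤.map (fst ℝ M2 M2) ≠ ⊥ := by
  intro h0
  apply h
  rw [expGroup, MonoidHom.map_closure, Subgroup.closure_eq_bot_iff]
  rintro _ ⟨g, ⟨X, hX, hg, -⟩, rfl⟩
  have : X.1 = 0 := (Submodule.mem_bot ℝ).1 (h0.le ⟨X, hX, rfl⟩)
  exact Subtype.ext (by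
    rw [MonoidHom.coe_fst, hg, this, exp_zero, Matrix.SpecialLinearGroup.coe_one])

theorem map_snd_ne_bot {𝔤 : Submodule ℝ (M2 × M2)}
    (h : (expGroup 𝔤).map (MonoidHom.snd SL2 SL2) ≠ ⊥) : 𝔤.map (snd ℝ M2 M2) ≠ ⊥ := by
  intro h0
  apply h
  rw [expGroup, MonoidHom.map_closure, Subgroup.closure_eq_bot_iff]
  rintro _ ⟨g, ⟨X, hX, -, hg⟩, rfl⟩
  have : X.2 = 0 := (Submodule.mem_bot ℝ).1 (h0.le ⟨X, hX, rfl⟩)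
  exact Subtype.ext (by
    rw [MonoidHom.coe_snd, hg, this, exp_zero, Matrix.SpecialLinearGroup.coe_one])

end EinAdS

end

open EinAdS in
theorem proposition4p1p4
    (G : Subgroup (EinAdS.SL2 × EinAdS.SL2))
    (𝔤 : Submodule ℝ (EinAdS.M2 × EinAdS.M2))
    (hG : EinAdS.IsConnectedLieSubgroup G 𝔤)
    (hdim : 2 ≤ Module.finrank ℝ 𝔤)
    (hfix : ¬ EinAdS.FixesPointEin12 G)
    (hP₁ : G.map (MonoidHom.fst EinAdS.SL2 EinAdS.SL2) ≠ ⊥)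
    (hP₂ : G.map (MonoidHom.snd EinAdS.SL2 EinAdS.SL2) ≠ ⊥) :
    ∃ H : Subgroup (EinAdS.SL2 × EinAdS.SL2),
      (H = G ∨ H = EinAdS.swapSubgroup G) ∧
      (∃ K, EinAdS.Listed {lam : ℝ | lam ≠ 0} K ∧ EinAdS.ConjInSL H K) ∧
      (∃ K, EinAdS.Listed {lam : ℝ | 0 < lam} K ∧ EinAdS.ConjInConf H K) := by
  have hlie : LieClosed 𝔤 := hG.lie_mem
  obtain ⟨P, hP⟩ := exists_conj_isModel (𝔭 := 𝔤.map (LinearMap.fst ℝ M2 M2))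
    (by rintro _ ⟨X, hX, rfl⟩; exact (hG.trace_eq_zero hX).1)
    (map_fst_ne_bot (hG.eq_expGroup ▸ hP₁)) (lie_mem_map_fst hlie)
  obtain ⟨Q, hQ⟩ := exists_conj_isModel (𝔭 := 𝔤.map (LinearMap.snd ℝ M2 M2))
    (by rintro _ ⟨X, hX, rfl⟩; exact (hG.trace_eq_zero hX).2)
    (map_snd_ne_bot (hG.eq_expGroup ▸ hP₂)) (lie_mem_map_snd hlie)
  have key := listed_or_listed_swap (hlie.conj (P, Q))
    (by rwa [LinearEquiv.finrank_map_eq])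
    (fun h => hfix (hG.eq_expGroup ▸ h.of_conj.fixesPoint))
    (by rwa [map_fst_conj]) (by rwa [map_snd_conj])
  obtain ⟨H, hH, K, hK, hHK⟩ : ∃ H, (H = G ∨ H = swapSubgroup G) ∧
      ∃ K, Listed {lam : ℝ | lam ≠ 0} K ∧ ConjInSL H K := by
    rw [hG.eq_expGroup]
    rcases key with h | h
    · exact ⟨_, .inl rfl, _, h, (P, Q), map_conj_expGroup _ _⟩
    -- The swap also exchanges the two conjugators.
    · refine ⟨_, .inr rfl, _, h, (Q, P), ?_⟩
      rw [swapSubgroup_expGroup, map_conj_expGroup, swapAlg_conj]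
      rfl
  exact ⟨H, hH, ⟨K, hK, hHK⟩, exists_listed_pos hK hHK⟩
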